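/- Let $\mathcal H\subset\mathbb R$ be open with $(-a_0,a_0)\subset\mathcal H\subset(-a,a)$ for some $0<a_0<a<\infty$. Let $J\in C^2_c(\mathbb R)$ be nonnegative and even, nonincreasing on $[0,\infty)$, with $\int_{\mathbb R}J=1$ and $\{J\neq0\}=(-d,d)$ for some $d>0$, and put $Lg=J*g-g$. Let $u_0\in L^\infty(\mathbb R)$ satisfy $u_0\ge0$, $u_0=0$ in $\mathcal H$ and $\int_{\mathbb R}u_0(x)(1+x^2)\,dx<\infty$. Let $u\in C([0,\infty);L^1(\mathbb R,(1+x^2)\,dx))$ be the solution of $$\partial_tu=Lu\ \text{ in }(\mathbb R\setminus\mathcal H)\times(0,\infty),\qquad u=0\ \text{ in }\mathcal H\times(0,\infty),\qquad u(\cdot,0)=u_0 .$$ For $b^\pm\ge0$ consider the stationary problem $$L\phi=0\ \text{ in }\mathbb R\setminus\mathcal H,\qquad \phi=0\ \text{ in }\mathcal H,\qquad \sup_{x\in\mathbb R}\bigl|\phi(x)-\max\{b^+x,-b^-x\}\bigr|<\infty ,\tag{S}$$ where $\phi$ is locally integrable. Let $\phi_+$, $\phi_-$ and $\phi_1$ solve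 (S) with $(b^+,b^-)=(1,0)$, $(0,1)$ and $(1,1)$ respectively. Let $\mathbb R_+=(0,\infty)$, $\mathbb R_-=(-\infty,0)$, and $$M(t)=\int_{\mathbb R}u(x,t)\,dx,\quad M_1^\pm(t)=\int_{\mathbb R_\pm}u(x,t)|x|\,dx,\quad M_1(t)=\int_{\mathbb R}u(x,t)|x|\,dx,\quad M_2(t)=\int_{\mathbb R}u(x,t)x^2\,dx,$$ $$\bar M_1^\pm=\int_{\mathbb R}u_0\phi_\pm\,dx,\qquad \bar M_1=\int_{\mathbb R}u_0\phi_1\,dx .$$ Then $u(\cdot,t)\in L^\infty(\mathbb R)$ for every $t\ge0$, and the following hold. 1. There are constants $C,C'>0$, independent of $t$, such that for all $t\ge0$ $$|M_1^\pm(t)-\bar M_1^\pm|\le C\,M(t)\le C'\,\|u(\cdot,t)\|_{L^\infty(\mathbb R)}^{1/2}.$$ In particular, there is $K$ such that $M(t)\le K\|u(\cdot,t)\|_{L^\infty(\mathbb R)}^{1/2}$ for all $t\ge0$. 2. As $t\to\infty$, $$M(t)=O(t^{-1/2}),\qquad |M_1^\pm(t)-\bar M_1^\pm|=O(t^{-1/2}),\qquad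 |M_1(t)-\bar M_1|=O(t^{-1/2}),$$ and there is a constant $K$ such that $M_2(t)\le M_2(0)+K\,t^{1/2}$ for all $t\ge0$. 3. In particular, $M(t)\to0$ and $M_1^\pm(t)\to\bar M_1^\pm=\int_{\mathbb R}u_0\phi_\pm\,dx$ as $t\to\infty$. -/

import Mathlib

open MeasureTheory Filter Topology Asymptotics Set

noncomputable section

namespace NonlocalHole

/-- The nonlocal operator `L g = J * g - g` on the real line. -/
def nonlocalOp (J g : ℝ → ℝ) (x : ℝ) : ℝ :=
  convolution J g (ContinuousLinearMap.lsmul ℝ ℝ) volume x - g x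

/-- The operator written out as an integral. -/
theorem nonlocalOp_eq (J g : ℝ → ℝ) (x : ℝ) :
    nonlocalOp J g x = (∫ y, J (x - y) * g y) - g x := by
  unfold nonlocalOp
  rw [convolution_eq_swap]
  simp [smul_eq_mul]

/-- The hole: an open set, not necessarily connected, lying between two bounded intervals
centred at the origin. -/
structure IsHole (H : Set ℝ) : Prop where
  isOpen : IsOpen H
  between : ∃ a₀ a : ℝ, 0 < a₀ ∧ a₀ < a ∧ Ioo (-a₀) a₀ ⊆ H ∧ H ⊆ Ioo (-a) a

/-- The convolution kernel. `Function.support J` is the set where `J ≠ 0`; since `J` is continuous,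
even, nonnegative and nonincreasing on `[0, ∞)`, this set is an open interval `(-d, d)` exactly when
the closed support is `[-d, d]`. -/
structure IsKernel (J : ℝ → ℝ) (d : ℝ) : Prop where
  contDiff : ContDiff ℝ 2 J
  nonneg : ∀ x, 0 ≤ J x
  d_pos : 0 < d
  support_eq : Function.support J = Ioo (-d) d
  integral_eq_one : ∫ x, J x = 1
  even : ∀ x, J (-x) = J x
  antitone : AntitoneOn J (Ici 0)

/-- The initial datum: nonnegative, bounded, vanishing in the hole, with finite second momentum
(all in the sense of classes of measurable functions modulo null sets). -/
structure IsInitialDatum (H : Set ℝ) (u₀ : ℝ → ℝ) : Prop where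
  nonneg : ∀ᵐ x, 0 ≤ u₀ x
  memLp_top : MemLp u₀ ⊤ volume
  zero_on_hole : ∀ᵐ x, x ∈ H → u₀ x = 0
  integrable : Integrable (fun x => (1 + x ^ 2) * u₀ x)

/-- `u`, written `u t x`, is a solution in `C([0, ∞); L¹(ℝ, (1 + x²) dx))` of the exterior
Dirichlet problem `∂ₜ u = L u` in `(ℝ \ H) × (0, ∞)`, `u = 0` in `H × (0, ∞)`, `u(·, 0) = u₀`.
The exceptional null set of points `x` in the equation does not depend on `t`. -/
structure IsSolution (H : Set ℝ) (J u₀ : ℝ → ℝ) (u : ℝ → ℝ → ℝ) : Prop where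
  integrable : ∀ t, 0 ≤ t → Integrable (fun x => (1 + x ^ 2) * u t x)
  continuous : ∀ t₀, 0 ≤ t₀ →
    Tendsto (fun t => ∫ x, (1 + x ^ 2) * |u t x - u t₀ x|) (𝓝[Ici 0] t₀) (𝓝 0)
  equation : ∀ᵐ x, x ∉ H → ∀ t, 0 < t → HasDerivAt (fun s => u s x) (nonlocalOp J (u t) x) t
  zero_on_hole : ∀ᵐ x, x ∈ H → ∀ t, 0 < t → u t x = 0
  initial : ∀ᵐ x, u 0 x = u₀ x

/-- `φ` solves the stationary problem `L φ = 0` in `ℝ \ H`, `φ = 0` in `H`, with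
`φ(x) - max {b⁺ x, -b⁻ x}` bounded on the real line. -/
structure IsStationary (H : Set ℝ) (J : ℝ → ℝ) (bp bm : ℝ) (φ : ℝ → ℝ) : Prop where
  locallyIntegrable : LocallyIntegrable φ volume
  equation : ∀ x, x ∉ H → nonlocalOp J φ x = 0
  zero_on_hole : ∀ x, x ∈ H → φ x = 0
  bounded : ∃ C : ℝ, ∀ x, |φ x - max (bp * x) (-(bm * x))| ≤ C

/-- The mass `M(t)`. -/
def mass (u : ℝ → ℝ → ℝ) (t : ℝ) : ℝ := ∫ x, u t x

/-- The first momentum in the right half-line. -/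
def firstMomentumPos (u : ℝ → ℝ → ℝ) (t : ℝ) : ℝ := ∫ x in Ioi 0, u t x * |x|

/-- The first momentum in the left half-line. -/
def firstMomentumNeg (u : ℝ → ℝ → ℝ) (t : ℝ) : ℝ := ∫ x in Iio 0, u t x * |x|

/-- The first momentum `M₁(t)` in the whole line. -/
def firstMomentum (u : ℝ → ℝ → ℝ) (t : ℝ) : ℝ := ∫ x, u t x * |x|

/-- The second momentum `M₂(t)`. -/
def secondMomentum (u : ℝ → ℝ → ℝ) (t : ℝ) : ℝ := ∫ x, u t x * x ^ 2

/-- The norm of `L^∞(ℝ)`, for functions in that space. -/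
def supNorm (f : ℝ → ℝ) : ℝ := (eLpNorm f ⊤ volume).toReal

end NonlocalHole

end

/-! Since `J` is even, `L` is symmetric. If `φ` vanishes in the hole and `Lφ = 0` outside it, then
`∫ u φ` has zero time derivative. As `φ` is within a bounded distance of `max {b⁺x, -b⁻x}`, the
corresponding first momentum differs from `∫ u₀ φ` by at most a constant times the mass. Everything
about first momenta thus reduces to the decay of the mass.

Near the hole, the mass absorbed there beats the convexity of `|x|`: for a suitable `A` the weight
`|x| + A`, cut off in the hole, is a supersolution (`exists_barrier`). Hence the mass and the first
momentum stay bounded. With the first momentum at most `K`, splitting the line at `|x| = R` bounds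
the mass by `2R‖u‖_∞ + K/R`, and optimising `R` gives the square root of the sup norm. The same
splitting with `E = ∫ u²` gives `M ≤ C E^(1/3)` (`integral_le_energy_rpow`).

The decay rate comes from the energy, with `E' = -2D` and `D = -∫ u Lu`. The Nash-type bound `E ≤
C(1 + r)²D + M²/(2r)`, combined with `M ≤ C E^(1/3)`, yields `E^(5/3) ≤ L D`, so `E = O(t^(-3/2))`
and `M = O(t^(-1/2))`. Finally `L(x²) ≤ d²`, so `M₂' ≤ d² M`, and integration gives the growth
`t^(1/2)`. -/

noncomputable section

namespace NonlocalHole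

/-- The convolution `J * f`, written out as an integral. -/
def smear (J f : ℝ → ℝ) (x : ℝ) : ℝ := ∫ y, J (x - y) * f y

theorem nonlocalOp_eq_smear_sub (J f : ℝ → ℝ) (x : ℝ) :
    nonlocalOp J f x = smear J f x - f x :=
  nonlocalOp_eq J f x

/-! ### Averages against the kernel. -/

namespace IsKernel

variable {J : ℝ → ℝ} {d : ℝ}

theorem cont (hJ : IsKernel J d) : Continuous J := hJ.contDiff.continuous

theorem abs_arg (hJ : IsKernel J d) (x : ℝ) : J |x| = J x := by
  rcases abs_choice x with h | h <;> rw [h]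
  exact hJ.even x

theorem eq_zero (hJ : IsKernel J d) {x : ℝ} (hx : d ≤ |x|) : J x = 0 := by
  by_contra h
  have : x ∈ Ioo (-d) d := hJ.support_eq ▸ h
  exact absurd (abs_lt.2 this) (not_lt.2 hx)

theorem pos (hJ : IsKernel J d) {x : ℝ} (hx : |x| < d) : 0 < J x := by
  have : x ∈ Function.support J := hJ.support_eq ▸ abs_lt.1 hx
  exact (hJ.nonneg x).lt_of_ne' this

theorem abs_lt_of_ne_zero (hJ : IsKernel J d) {x : ℝ} (hx : J x ≠ 0) : |x| < d := by
  by_contra h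
  exact hx (hJ.eq_zero (not_lt.1 h))

theorem anti_abs (hJ : IsKernel J d) {x y : ℝ} (h : |x| ≤ |y|) : J y ≤ J x := by
  rw [← hJ.abs_arg x, ← hJ.abs_arg y]
  exact hJ.antitone (abs_nonneg x) (abs_nonneg y) h

theorem le_zero (hJ : IsKernel J d) (x : ℝ) : J x ≤ J 0 :=
  hJ.anti_abs (by simp)

theorem hasCompactSupport (hJ : IsKernel J d) : HasCompactSupport J := by
  refine HasCompactSupport.intro (isCompact_Icc (a := -d) (b := d)) fun x hx => hJ.eq_zero ?_
  by_contra h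
  exact hx (Ioo_subset_Icc_self (abs_lt.1 (not_le.1 h)))

theorem integrable (hJ : IsKernel J d) : Integrable J :=
  hJ.cont.integrable_of_hasCompactSupport hJ.hasCompactSupport

theorem comm (hJ : IsKernel J d) (x y : ℝ) : J (x - y) = J (y - x) := by
  rw [← hJ.even, neg_sub]

theorem integrable_mul (hJ : IsKernel J d) {f : ℝ → ℝ} (hf : LocallyIntegrable f) (x : ℝ) :
    Integrable (fun y => J (x - y) * f y) := by
  have hc : Continuous fun y => J (x - y) := hJ.cont.comp (continuous_const.sub continuous_id)
  have hs : HasCompactSupport fun y => J (x - y) :=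
    hJ.hasCompactSupport.comp_homeomorph (Homeomorph.subLeft x)
  exact hf.integrable_smul_left_of_hasCompactSupport hc hs

theorem integral_sub (hJ : IsKernel J d) (x : ℝ) : ∫ y, J (x - y) = 1 := by
  rw [integral_sub_left_eq_self J volume x, hJ.integral_eq_one]

theorem smear_const (hJ : IsKernel J d) (c x : ℝ) : smear J (fun _ => c) x = c := by
  rw [smear, integral_mul_const, hJ.integral_sub, one_mul]

theorem smear_mono (hJ : IsKernel J d) {f g : ℝ → ℝ} (hf : LocallyIntegrable f)
    (hg : LocallyIntegrable g) {x : ℝ} (h : ∀ᵐ y, |x - y| < d → f y ≤ g y) :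
    smear J f x ≤ smear J g x := by
  refine integral_mono_ae (hJ.integrable_mul hf x) (hJ.integrable_mul hg x) ?_
  filter_upwards [h] with y hy
  by_cases hxy : |x - y| < d
  · exact mul_le_mul_of_nonneg_left (hy hxy) (hJ.nonneg _)
  · simp [hJ.eq_zero (not_lt.1 hxy)]

theorem smear_nonneg (hJ : IsKernel J d) {f : ℝ → ℝ} (h : ∀ᵐ y, 0 ≤ f y) (x : ℝ) :
    0 ≤ smear J f x := by
  refine integral_nonneg_of_ae ?_
  filter_upwards [h] with y hy using mul_nonneg (hJ.nonneg _) hy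

theorem abs_smear_le (hJ : IsKernel J d) {f : ℝ → ℝ} (hf : Integrable f) (x : ℝ) :
    |smear J f x| ≤ J 0 * ∫ y, |f y| := by
  rw [← integral_const_mul]
  refine (abs_integral_le_integral_abs).trans
    (integral_mono (hJ.integrable_mul hf.locallyIntegrable x).abs (hf.abs.const_mul _) fun y => ?_)
  simp only [abs_mul, abs_of_nonneg (hJ.nonneg _)]
  exact mul_le_mul_of_nonneg_right (hJ.le_zero _) (abs_nonneg _)

theorem smear_const_mul (c : ℝ) (f : ℝ → ℝ) (x : ℝ) :
    smear J (fun y => c * f y) x = c * smear J f x := by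
  rw [smear, smear, ← integral_const_mul]
  exact integral_congr_ae (ae_of_all _ fun y => by ring)

theorem smear_add (hJ : IsKernel J d) {f g : ℝ → ℝ} (hf : LocallyIntegrable f)
    (hg : LocallyIntegrable g) (x : ℝ) :
    smear J (fun y => f y + g y) x = smear J f x + smear J g x := by
  rw [smear, smear, smear, ← integral_add (hJ.integrable_mul hf x) (hJ.integrable_mul hg x)]
  exact integral_congr_ae (ae_of_all _ fun y => by ring)

/-- An even kernel has zero first moment. -/
theorem smear_id (hJ : IsKernel J d) (x : ℝ) : smear J (fun y => y) x = x := by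
  have hodd : ∫ z, J z * z = 0 := by
    have h := integral_neg_eq_self (fun z => J z * z) volume
    simp only [hJ.even, mul_neg, integral_neg] at h
    linarith
  have h1 : Integrable fun z => J z * z := by
    simpa [hJ.even] using (hJ.integrable_mul continuous_id.locallyIntegrable 0)
  have h2 := integral_sub_left_eq_self (fun z => J z * (x - z)) volume x
  simp only [sub_sub_cancel] at h2
  rw [smear, h2]
  simp only [mul_sub]
  rw [MeasureTheory.integral_sub (hJ.integrable.mul_const x) h1, hodd, integral_mul_const,
    hJ.integral_eq_one]
  ring

theorem smear_abs_le (hJ : IsKernel J d) (x : ℝ) : smear J (fun y => |y|) x ≤ |x| + d := by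
  rw [← hJ.smear_const (|x| + d) x]
  refine hJ.smear_mono continuous_abs.locallyIntegrable continuous_const.locallyIntegrable
    (ae_of_all _ fun y hy => ?_)
  have := abs_sub_abs_le_abs_sub y x
  rw [abs_sub_comm] at this
  linarith

/-- The window `|x - y| < d` does not cross the origin, so `|y|` is linear on it. -/
theorem smear_abs (hJ : IsKernel J d) {x : ℝ} (hx : d ≤ |x|) :
    smear J (fun y => |y|) x = |x| := by
  rcases le_total 0 x with h | h
  · rw [abs_of_nonneg h] at hx ⊢
    refine Eq.trans (integral_congr_ae (ae_of_all _ fun y => ?_)) (hJ.smear_id x)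
    by_cases hxy : |x - y| < d
    · have : 0 ≤ y := by linarith [(abs_lt.1 hxy).2]
      simp [abs_of_nonneg this]
    · simp [hJ.eq_zero (not_lt.1 hxy)]
  · rw [abs_of_nonpos h] at hx ⊢
    have h1 : smear J (fun y => (-1) * y) x = -x := by
      rw [smear_const_mul, hJ.smear_id]; ring
    refine Eq.trans (integral_congr_ae (ae_of_all _ fun y => ?_)) h1
    by_cases hxy : |x - y| < d
    · have : y ≤ 0 := by linarith [(abs_lt.1 hxy).1]
      simp [abs_of_nonpos this]
    · simp [hJ.eq_zero (not_lt.1 hxy)]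

/-- On the window, `y² = (x - y)² + 2xy - x²` lies below the affine function obtained by replacing
`(x - y)²` by `d²`, and affine functions are fixed by the average. -/
theorem smear_sq_le (hJ : IsKernel J d) (x : ℝ) : smear J (fun y => y ^ 2) x ≤ x ^ 2 + d ^ 2 := by
  have h : smear J (fun y => (d ^ 2 - x ^ 2) + (2 * x) * y) x = d ^ 2 + x ^ 2 := by
    rw [hJ.smear_add continuous_const.locallyIntegrable
      (by fun_prop : Continuous fun y : ℝ => 2 * x * y).locallyIntegrable, hJ.smear_const, smear_const_mul,
      hJ.smear_id]
    ring
  rw [add_comm, ← h]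
  refine hJ.smear_mono (continuous_pow 2).locallyIntegrable
    (by fun_prop : Continuous fun y : ℝ => (d ^ 2 - x ^ 2) + (2 * x) * y).locallyIntegrable
    (ae_of_all _ fun y hy => ?_)
  have := sq_lt_sq' (by linarith [(abs_lt.1 hy).1]) (abs_lt.1 hy).2
  nlinarith

/-- A point within reach of the hole sees a fixed portion of it. -/
theorem exists_le_smear_hole (hJ : IsKernel J d) {H : Set ℝ} (hH : IsHole H) :
    ∃ c : ℝ, 0 < c ∧ ∀ x, |x| ≤ d → c ≤ smear J (H.indicator fun _ => 1) x := by
  obtain ⟨a₀, a, ha₀, -, hsub, -⟩ := hH.between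
  have hd := hJ.d_pos
  -- With this `b`, the interval `[b/2, b]` (reflected when `x ≤ 0`) lies in the hole and within
  -- distance `d - b/2` of every `x` in `[0, d]`. There the kernel is at least `J (d - b/2) > 0`.
  set b := min a₀ d / 2 with hb
  have hb0 : 0 < b := by have := lt_min ha₀ hd; linarith
  have hba : 2 * b ≤ a₀ := by have := min_le_left a₀ d; linarith
  have hbd : 2 * b ≤ d := by have := min_le_right a₀ d; linarith
  have hpos : 0 < J (d - b / 2) := hJ.pos (by rw [abs_lt]; constructor <;> linarith)
  have hloc : LocallyIntegrable (H.indicator fun _ => (1 : ℝ)) :=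
    (locallyIntegrable_const (1 : ℝ)).indicator hH.isOpen.measurableSet
  have key : ∀ x p q : ℝ, q - p = b / 2 → -a₀ < p → q < a₀ →
      (∀ y ∈ Icc p q, |x - y| ≤ d - b / 2) →
      J (d - b / 2) * (b / 2) ≤ smear J (H.indicator fun _ => 1) x := by
    intro x p q hpq hp hq hy
    have hI : ∫ y, (Icc p q).indicator (fun _ => J (d - b / 2)) y = J (d - b / 2) * (b / 2) := by
      rw [integral_indicator measurableSet_Icc, setIntegral_const]
      rw [Measure.real, Real.volume_Icc, hpq, ENNReal.toReal_ofReal (by positivity), smul_eq_mul,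
        mul_comm]
    rw [← hI]
    refine integral_mono ?_ (hJ.integrable_mul hloc x) fun y => ?_
    · exact (integrable_indicator_iff measurableSet_Icc).2
        (integrableOn_const (by simp [Real.volume_Icc]))
    · by_cases hyI : y ∈ Icc p q
      · have hyH : y ∈ H := hsub ⟨by linarith [hyI.1], by linarith [hyI.2]⟩
        simp only [indicator_of_mem hyI, indicator_of_mem hyH, mul_one]
        refine hJ.anti_abs ((hy y hyI).trans (le_abs_self _))
      · rw [indicator_of_notMem hyI]
        exact mul_nonneg (hJ.nonneg _) (indicator_nonneg (fun _ _ => zero_le_one) _)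
  refine ⟨J (d - b / 2) * (b / 2), by positivity, fun x hx => ?_⟩
  obtain ⟨h1, h2⟩ := abs_le.1 hx
  rcases le_total 0 x with h | h
  · refine key x (b / 2) b (by ring) (by linarith) (by linarith) fun y hy => ?_
    obtain ⟨h3, h4⟩ := hy
    rw [abs_le]; constructor <;> linarith
  · refine key x (-b) (-(b / 2)) (by ring) (by linarith) (by linarith) fun y hy => ?_
    obtain ⟨h3, h4⟩ := hy
    rw [abs_le]; constructor <;> linarith

end IsKernel

/-! ### Weighted integrability and symmetry of the convolution. -/

section Weighted

variable {J : ℝ → ℝ} {d : ℝ} {f ψ : ℝ → ℝ} {C : ℝ}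

theorem aestronglyMeasurable_of_weighted (hf : Integrable fun x => (1 + x ^ 2) * f x) :
    AEStronglyMeasurable f volume := by
  have h : AEStronglyMeasurable (fun x : ℝ => (1 + x ^ 2)⁻¹) volume :=
    (Continuous.inv₀ (by fun_prop) fun x => by positivity).aestronglyMeasurable
  refine (h.mul hf.1).congr (ae_of_all _ fun x => ?_)
  have : (1 + x ^ 2) ≠ 0 := by positivity
  simp [this]

theorem integrable_weight_mul (hf : Integrable fun x => (1 + x ^ 2) * f x)
    (hψ : AEStronglyMeasurable ψ volume) (hC : ∀ x, |ψ x| ≤ C * (1 + x ^ 2)) :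
    Integrable fun x => ψ x * f x := by
  refine (hf.abs.const_mul C).mono' (hψ.mul (aestronglyMeasurable_of_weighted hf))
    (ae_of_all _ fun x => ?_)
  have : 0 ≤ 1 + x ^ 2 := by positivity
  rw [Real.norm_eq_abs, abs_mul, abs_mul, abs_of_nonneg this, ← mul_assoc]
  exact mul_le_mul_of_nonneg_right (hC x) (abs_nonneg _)

theorem integrable_of_weighted (hf : Integrable fun x => (1 + x ^ 2) * f x) : Integrable f := by
  simpa using integrable_weight_mul (ψ := fun _ => 1) (C := 1) hf aestronglyMeasurable_const
    fun x => by simp [sq_nonneg]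

theorem integrable_abs_weighted (hf : Integrable fun x => (1 + x ^ 2) * f x) :
    Integrable fun x => (1 + x ^ 2) * |f x| := by
  refine hf.abs.congr (ae_of_all _ fun x => ?_)
  have : 0 ≤ 1 + x ^ 2 := by positivity
  simp only [abs_mul, abs_of_nonneg this]

/-- Where `J (x - y) ≠ 0` the weights at `x` and `y` are comparable, so the integrand is dominated
by that of the convolution of `J` with `(1 + y²)|f|`. This justifies every use of Fubini against
weights of quadratic growth. -/
theorem integrable_kernel_prod (hJ : IsKernel J d) (hf : Integrable fun x => (1 + x ^ 2) * f x)
    (hψ : AEStronglyMeasurable ψ volume) (hC : ∀ x, |ψ x| ≤ C * (1 + x ^ 2)) :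
    Integrable (fun p : ℝ × ℝ => ψ p.1 * (J (p.1 - p.2) * f p.2)) (volume.prod volume) := by
  have hC0 : 0 ≤ C := by simpa using (abs_nonneg _).trans (hC 0)
  have h := Integrable.convolution_integrand (ContinuousLinearMap.mul ℝ ℝ)
    (integrable_abs_weighted hf) hJ.integrable
  refine (h.const_mul (C * (2 * (1 + d ^ 2)))).mono' ?_ (ae_of_all _ fun p => ?_)
  · refine hψ.comp_fst.mul (AEStronglyMeasurable.mul ?_
      (aestronglyMeasurable_of_weighted hf).comp_snd)
    exact (hJ.cont.comp (continuous_fst.sub continuous_snd)).aestronglyMeasurable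
  · simp only [ContinuousLinearMap.mul_apply', Real.norm_eq_abs, abs_mul,
      abs_of_nonneg (hJ.nonneg _)]
    by_cases hp : J (p.1 - p.2) = 0
    · simp [hp]
    · have h1 := abs_lt.1 (hJ.abs_lt_of_ne_zero hp)
      have h2 : 1 + p.1 ^ 2 ≤ 2 * (1 + d ^ 2) * (1 + p.2 ^ 2) := by
        nlinarith [sq_lt_sq' h1.1 h1.2, sq_nonneg (p.1 - 2 * p.2), mul_nonneg (sq_nonneg d)
          (sq_nonneg p.2)]
      calc |ψ p.1| * (J (p.1 - p.2) * |f p.2|)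
          ≤ C * (2 * (1 + d ^ 2) * (1 + p.2 ^ 2)) * (J (p.1 - p.2) * |f p.2|) := by
            refine mul_le_mul_of_nonneg_right ((hC _).trans ?_)
              (mul_nonneg (hJ.nonneg _) (abs_nonneg _))
            exact mul_le_mul_of_nonneg_left h2 hC0
        _ = _ := by ring

theorem integrable_mul_smear (hJ : IsKernel J d) (hf : Integrable fun x => (1 + x ^ 2) * f x)
    (hψ : AEStronglyMeasurable ψ volume) (hC : ∀ x, |ψ x| ≤ C * (1 + x ^ 2)) :
    Integrable fun x => ψ x * smear J f x := by
  simpa only [smear, integral_const_mul] using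
    (integrable_kernel_prod hJ hf hψ hC).integral_prod_left

theorem integrable_smear_mul (hJ : IsKernel J d) (hf : Integrable fun x => (1 + x ^ 2) * f x)
    (hψ : AEStronglyMeasurable ψ volume) (hC : ∀ x, |ψ x| ≤ C * (1 + x ^ 2)) :
    Integrable fun x => f x * smear J ψ x := by
  refine (integrable_kernel_prod hJ hf hψ hC).integral_prod_right.congr (ae_of_all _ fun y => ?_)
  simp only [smear, ← integral_const_mul]
  refine integral_congr_ae (ae_of_all _ fun x => ?_)
  simp only [hJ.comm x y]
  ring

/-- Fubini and evenness of `J`; this moves `L` from the solution onto the test function. -/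
theorem integral_mul_smear_comm (hJ : IsKernel J d) (hf : Integrable fun x => (1 + x ^ 2) * f x)
    (hψ : AEStronglyMeasurable ψ volume) (hC : ∀ x, |ψ x| ≤ C * (1 + x ^ 2)) :
    ∫ x, ψ x * smear J f x = ∫ x, f x * smear J ψ x := by
  simp only [smear, ← integral_const_mul]
  rw [integral_integral_swap (integrable_kernel_prod hJ hf hψ hC)]
  refine integral_congr_ae (ae_of_all _ fun y => integral_congr_ae (ae_of_all _ fun x => ?_))
  simp only [hJ.comm x y]
  ring

theorem integrable_smear (hJ : IsKernel J d) (hf : Integrable fun x => (1 + x ^ 2) * f x) :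
    Integrable (smear J f) := by
  simpa using integrable_mul_smear (ψ := fun _ => 1) (C := 1) hJ hf aestronglyMeasurable_const
    fun x => by simp [sq_nonneg]

end Weighted

/-! ### A Nash-type inequality from translations. -/

section Nash

variable {J : ℝ → ℝ} {d : ℝ} {f : ℝ → ℝ}

/-- The autocorrelation of `f`. -/
def autocorr (f : ℝ → ℝ) (z : ℝ) : ℝ := ∫ x, f x * f (x - z)

/-- Half the squared `L²` distance between `f` and its translate by `z`. -/
def transGap (f : ℝ → ℝ) (z : ℝ) : ℝ := (∫ x, f x ^ 2) - autocorr f z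

theorem integrable_autocorr_prod (hf : Integrable f) :
    Integrable (fun p : ℝ × ℝ => f p.2 * f (p.2 - p.1)) (volume.prod volume) := by
  simpa using Integrable.convolution_integrand (ContinuousLinearMap.mul ℝ ℝ) hf hf.comp_neg

theorem integrable_autocorr (hf : Integrable f) : Integrable (autocorr f) :=
  (integrable_autocorr_prod hf).integral_prod_left

theorem integral_autocorr (hf : Integrable f) : ∫ z, autocorr f z = (∫ x, f x) ^ 2 := by
  unfold autocorr
  rw [integral_integral_swap (integrable_autocorr_prod hf)]
  simp only [integral_const_mul]
  have h (x : ℝ) : ∫ z, f (x - z) = ∫ z, f z := integral_sub_left_eq_self f volume x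
  simp only [h, integral_mul_const, sq]

theorem integrable_kernel_mul_autocorr (hJ : IsKernel J d) (hf : Integrable f) :
    Integrable fun z => J z * autocorr f z := by
  refine (integrable_autocorr hf).bdd_mul (c := J 0) hJ.cont.aestronglyMeasurable
    (ae_of_all _ fun z => ?_)
  rw [Real.norm_eq_abs, abs_of_nonneg (hJ.nonneg z)]
  exact hJ.le_zero z

theorem integral_kernel_mul_autocorr (hJ : IsKernel J d) (hf : Integrable f) :
    ∫ z, J z * autocorr f z = ∫ x, f x * smear J f x := by
  have hI : Integrable (fun p : ℝ × ℝ => J p.1 * (f p.2 * f (p.2 - p.1)))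
      (volume.prod volume) := by
    refine (integrable_autocorr_prod hf).bdd_mul (c := J 0)
      (hJ.cont.comp continuous_fst).aestronglyMeasurable (ae_of_all _ fun z => ?_)
    rw [Real.norm_eq_abs, abs_of_nonneg (hJ.nonneg _)]
    exact hJ.le_zero _
  simp only [autocorr, ← integral_const_mul]
  rw [integral_integral_swap hI]
  refine integral_congr_ae (ae_of_all _ fun x => ?_)
  have h := integral_sub_left_eq_self (fun z => J z * f (x - z)) volume x
  simp only [sub_sub_cancel] at h
  simp only [smear, h, ← integral_const_mul]
  refine integral_congr_ae (ae_of_all _ fun z => ?_)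
  ring

theorem autocorr_nonneg (h0 : ∀ᵐ x, 0 ≤ f x) (z : ℝ) : 0 ≤ autocorr f z := by
  refine integral_nonneg_of_ae ?_
  filter_upwards [h0, (measurePreserving_sub_right volume z).quasiMeasurePreserving.ae h0]
    with x h1 h2 using mul_nonneg h1 h2

theorem memLp_translate (h2 : MemLp f 2 volume) (z : ℝ) :
    MemLp (fun x => f (x - z)) 2 volume :=
  h2.comp_measurePreserving (measurePreserving_sub_right volume z)

theorem two_mul_transGap (h2 : MemLp f 2 volume) (z : ℝ) :
    2 * transGap f z = ∫ x, (f x - f (x - z)) ^ 2 := by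
  have hz := memLp_translate h2 z
  have i1 : Integrable fun x => f x ^ 2 := h2.integrable_sq
  have i2 : Integrable fun x => f (x - z) ^ 2 := hz.integrable_sq
  have i3 : Integrable fun x => f x * f (x - z) := h2.integrable_mul hz
  have e : ∫ x, f (x - z) ^ 2 = ∫ x, f x ^ 2 :=
    integral_sub_right_eq_self (fun x => f x ^ 2) z
  have h : (fun x => (f x - f (x - z)) ^ 2) =
      fun x => (f x ^ 2 + f (x - z) ^ 2) - 2 * (f x * f (x - z)) := by
    ext x; ring
  have i12 : Integrable fun x => f x ^ 2 + f (x - z) ^ 2 := i1.add i2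
  rw [h, integral_sub i12 (i3.const_mul 2), integral_add i1 i2, integral_const_mul, e, transGap,
    autocorr]
  ring

theorem transGap_nonneg (h2 : MemLp f 2 volume) (z : ℝ) : 0 ≤ transGap f z := by
  have : 0 ≤ 2 * transGap f z := by
    rw [two_mul_transGap h2]
    exact integral_nonneg fun x => sq_nonneg _
  linarith

/-- Insert the intermediate translate and use `(p + q)² ≤ 2p² + 2q²`. -/
theorem transGap_add_le (h2 : MemLp f 2 volume) (z w : ℝ) :
    transGap f (z + w) ≤ 2 * transGap f z + 2 * transGap f w := by
  have hz := memLp_translate h2 z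
  have hzw := memLp_translate h2 (z + w)
  have i0 : Integrable fun x => (f x - f (x - (z + w))) ^ 2 := (h2.sub hzw).integrable_sq
  have i1 : Integrable fun x => (f x - f (x - z)) ^ 2 := (h2.sub hz).integrable_sq
  have i2 : Integrable fun x => (f (x - z) - f (x - (z + w))) ^ 2 := (hz.sub hzw).integrable_sq
  have e : ∫ x, (f (x - z) - f (x - (z + w))) ^ 2 = ∫ x, (f x - f (x - w)) ^ 2 := by
    rw [← integral_sub_right_eq_self (fun x => (f x - f (x - w)) ^ 2) z]
    simp only [sub_sub]
  have : 2 * transGap f (z + w) ≤ 2 * (2 * transGap f z) + 2 * (2 * transGap f w) := by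
    rw [two_mul_transGap h2, two_mul_transGap h2 z, two_mul_transGap h2 w, ← e,
      ← integral_const_mul, ← integral_const_mul,
      ← integral_add (i1.const_mul 2) (i2.const_mul 2)]
    refine integral_mono i0 ((i1.const_mul 2).add (i2.const_mul 2)) fun x => ?_
    beta_reduce
    nlinarith [sq_nonneg ((f x - f (x - z)) - (f (x - z) - f (x - (z + w))))]
  linarith

/-- The dissipation `-∫ f Lf` is the `J`-average of the translation gaps; in particular it is
nonnegative for `f` in `L²`. -/
theorem integral_kernel_mul_transGap (hJ : IsKernel J d) (hf : Integrable f) :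
    ∫ z, J z * transGap f z = (∫ x, f x ^ 2) - ∫ x, f x * smear J f x := by
  simp only [transGap, mul_sub]
  rw [integral_sub (hJ.integrable.mul_const _) (integrable_kernel_mul_autocorr hJ hf),
    integral_mul_const, hJ.integral_eq_one, integral_kernel_mul_autocorr hJ hf, one_mul]

theorem intervalIntegrable_transGap (hf : Integrable f) (a b : ℝ) :
    IntervalIntegrable (transGap f) volume a b :=
  intervalIntegrable_const.sub (integrable_autocorr hf).intervalIntegrable

/-- Short translations are controlled by the Dirichlet form of `J`. -/
theorem transGap_le_of_abs_le (hJ : IsKernel J d) (hf : Integrable f) (h2 : MemLp f 2 volume)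
    {z : ℝ} (hz : |z| ≤ d / 4) :
    transGap f z ≤ 8 / (d * J (d / 2)) * ((∫ x, f x ^ 2) - ∫ x, f x * smear J f x) := by
  have hd := hJ.d_pos
  obtain ⟨hz1, hz2⟩ := abs_le.1 hz
  set η := d / 4 with hη
  have hη0 : 0 < η := by positivity
  set c := J (d / 2)
  have hc : 0 < c := hJ.pos (by rw [abs_of_pos (by positivity)]; linarith)
  set D := (∫ x, f x ^ 2) - ∫ x, f x * smear J f x with hD
  have hii := intervalIntegrable_transGap hf
  have hnn : ∀ a b : ℝ, 0 ≤ᵐ[volume.restrict (Ioc a b)] transGap f :=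
    fun a b => ae_of_all _ fun w => transGap_nonneg h2 w
  have hcomp : IntervalIntegrable (fun w => transGap f (z - w)) volume (-η) η := by
    simpa using (hii (z - -η) (z - η)).comp_sub_left z
  -- Average the splitting `z = w + (z - w)` over `|w| ≤ η`. Both `w` and `z - w` stay in `[-2η,
  -- 2η]`, where `J ≥ J (d/2)`, so both averages are controlled by the Dirichlet form.
  have s1 : 2 * η * transGap f z ≤
      2 * (∫ w in (-η)..η, transGap f w) + 2 * ∫ w in (-η)..η, transGap f (z - w) := by
    have : ∫ _ in (-η)..η, transGap f z ≤
        ∫ w in (-η)..η, (2 * transGap f w + 2 * transGap f (z - w)) := by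
      refine intervalIntegral.integral_mono_on (by linarith) intervalIntegrable_const
        (((hii _ _).const_mul 2).add (hcomp.const_mul 2)) fun w _ => ?_
      simpa using transGap_add_le h2 w (z - w)
    rw [intervalIntegral.integral_const, intervalIntegral.integral_add
      ((hii _ _).const_mul 2) (hcomp.const_mul 2), intervalIntegral.integral_const_mul,
      intervalIntegral.integral_const_mul, smul_eq_mul] at this
    linarith
  have s2 : ∫ w in (-η)..η, transGap f w ≤ ∫ w in (-(2 * η))..(2 * η), transGap f w :=
    intervalIntegral.integral_mono_interval (by linarith) (by linarith) (by linarith) (hnn _ _)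
      (hii _ _)
  have s3 : ∫ w in (-η)..η, transGap f (z - w) ≤ ∫ w in (-(2 * η))..(2 * η), transGap f w := by
    rw [intervalIntegral.integral_comp_sub_left (fun w => transGap f w)]
    exact intervalIntegral.integral_mono_interval (by linarith) (by linarith) (by linarith)
      (hnn _ _) (hii _ _)
  have s4 : c * ∫ w in (-(2 * η))..(2 * η), transGap f w ≤ D := by
    rw [hD, ← integral_kernel_mul_transGap hJ hf, intervalIntegral.integral_of_le (by linarith),
      ← integral_const_mul, ← integral_indicator measurableSet_Ioc]
    have hJG : Integrable fun z => J z * transGap f z := by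
      simp only [transGap, mul_sub]
      exact (hJ.integrable.mul_const _).sub (integrable_kernel_mul_autocorr hJ hf)
    refine integral_mono ?_ hJG fun w => ?_
    · exact (integrable_indicator_iff measurableSet_Ioc).2 (((hii _ _).const_mul c).1)
    · by_cases hw : w ∈ Ioc (-(2 * η)) (2 * η)
      · rw [indicator_of_mem hw]
        refine mul_le_mul_of_nonneg_right (hJ.anti_abs ?_) (transGap_nonneg h2 w)
        rw [abs_of_pos (show 0 < d / 2 by positivity), abs_le]
        obtain ⟨h3, h4⟩ := hw
        constructor <;> linarith
      · rw [indicator_of_notMem hw]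
        exact mul_nonneg (hJ.nonneg _) (transGap_nonneg h2 w)
  have s5 : d * c * transGap f z ≤ 8 * D := by
    have h := mul_le_mul_of_nonneg_left (s1.trans (add_le_add
      (mul_le_mul_of_nonneg_left s2 zero_le_two) (mul_le_mul_of_nonneg_left s3 zero_le_two))) hc.le
    have e : d = 4 * η := by rw [hη]; ring
    rw [e]
    nlinarith
  rw [div_mul_eq_mul_div, le_div_iff₀ (by positivity)]
  linarith

/-- Writing `z = z/2 + z/2` in `transGap_add_le`, each doubling of the range costs a factor 4,
consistent with quadratic growth in `|z|`. -/
theorem transGap_le_pow (hJ : IsKernel J d) (hf : Integrable f) (h2 : MemLp f 2 volume) (n : ℕ) :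
    ∀ z : ℝ, |z| ≤ 2 ^ n * (d / 4) → transGap f z ≤
      4 ^ n * (8 / (d * J (d / 2)) * ((∫ x, f x ^ 2) - ∫ x, f x * smear J f x)) := by
  induction n with
  | zero =>
    intro z hz
    simpa using transGap_le_of_abs_le hJ hf h2 (by simpa using hz)
  | succ n ih =>
    intro z hz
    have h := ih (z / 2) (by
      rw [abs_div, abs_of_pos (zero_lt_two' ℝ), div_le_iff₀ two_pos]
      rw [pow_succ] at hz
      linarith)
    have h' := transGap_add_le h2 (z / 2) (z / 2)
    rw [add_halves] at h'
    rw [pow_succ]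
    linarith

/-- A Nash-type inequality for the Dirichlet form of `J`. -/
theorem nash_inequality (hJ : IsKernel J d) :
    ∃ C > 0, ∀ f : ℝ → ℝ, Integrable f → MemLp f 2 volume → (∀ᵐ x, 0 ≤ f x) → ∀ r > 0,
      ∫ x, f x ^ 2 ≤ C * (1 + r) ^ 2 * ((∫ x, f x ^ 2) - ∫ x, f x * smear J f x) +
        (∫ x, f x) ^ 2 / (2 * r) := by
  have hd := hJ.d_pos
  have hc : 0 < J (d / 2) := hJ.pos (by rw [abs_of_pos (by positivity)]; linarith)
  refine ⟨8 / (d * J (d / 2)) * (1 + 8 / d) ^ 2, by positivity, fun f hf h2 h0 r hr => ?_⟩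
  set A := 8 / (d * J (d / 2)) with hA
  have hA0 : 0 < A := by positivity
  set E := ∫ x, f x ^ 2
  set D := E - ∫ x, f x * smear J f x
  have hD : 0 ≤ D := by
    have h := transGap_le_of_abs_le hJ hf h2 (z := 0) (by simp; positivity)
    exact nonneg_of_mul_nonneg_right ((transGap_nonneg h2 0).trans h) hA0
  -- Take the least admissible `n`: minimality gives `2 ^ n < (8 / d) r` if `n > 0`, and the
  -- summands 1 cover `n = 0`.
  obtain ⟨n, hn, hn4⟩ : ∃ n : ℕ, r ≤ 2 ^ n * (d / 4) ∧ (2 : ℝ) ^ n ≤ (1 + 8 / d) * (1 + r) := by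
    have hex : ∃ n : ℕ, r ≤ 2 ^ n * (d / 4) := by
      obtain ⟨n, hn⟩ := pow_unbounded_of_one_lt (r / (d / 4)) one_lt_two
      exact ⟨n, ((div_lt_iff₀ (by positivity)).1 hn).le⟩
    classical
    refine ⟨Nat.find hex, Nat.find_spec hex, ?_⟩
    have h8 : 0 < 8 / d := by positivity
    rcases hk : Nat.find hex with _ | k
    · rw [pow_zero]; nlinarith
    · have hlt := Nat.find_min hex (m := k) (by omega)
      have h3 : 2 ^ k * (d / 4) < r := not_le.1 hlt
      have h4 : (2 : ℝ) ^ k < 4 / d * r := by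
        rw [div_mul_eq_mul_div, lt_div_iff₀ hd]; linarith
      have h5 : 8 / d = 2 * (4 / d) := by ring
      rw [pow_succ]
      nlinarith
  have hG := transGap_le_pow hJ hf h2 n
  -- Integrate `∫ f² = transGap + autocorr` over `|z| ≤ r`. The autocorrelation is nonnegative with
  -- total integral `(∫ f)²`, so its mean over the interval is at most `(∫ f)² / (2r)`.
  have hQ : ∫ z in (-r)..r, autocorr f z ≤ (∫ x, f x) ^ 2 := by
    rw [← integral_autocorr hf, intervalIntegral.integral_of_le (by linarith)]
    exact setIntegral_le_integral (integrable_autocorr hf) (ae_of_all _ fun z => autocorr_nonneg h0 z)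
  have hGI : ∫ z in (-r)..r, transGap f z ≤ 2 * r * (4 ^ n * (A * D)) := by
    have : ∫ z in (-r)..r, transGap f z ≤ ∫ _ in (-r)..r, 4 ^ n * (A * D) := by
      refine intervalIntegral.integral_mono_on (by linarith) (intervalIntegrable_transGap hf _ _)
        intervalIntegrable_const fun z hz => hG z ((abs_le.2 hz).trans hn)
    rw [intervalIntegral.integral_const, smul_eq_mul] at this
    linarith
  have hsum : ∫ z in (-r)..r, transGap f z = 2 * r * E - ∫ z in (-r)..r, autocorr f z := by
    unfold transGap
    rw [intervalIntegral.integral_sub intervalIntegrable_const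
      (integrable_autocorr hf).intervalIntegrable, intervalIntegral.integral_const, smul_eq_mul]
    ring
  have h4 : (4 : ℝ) ^ n ≤ (1 + 8 / d) ^ 2 * (1 + r) ^ 2 := by
    rw [← mul_pow, show (4 : ℝ) = 2 ^ 2 by norm_num, ← pow_mul, mul_comm 2 n, pow_mul]
    exact pow_le_pow_left₀ (by positivity) hn4 2
  have hfin : E ≤ 4 ^ n * (A * D) + (∫ x, f x) ^ 2 / (2 * r) := by
    rw [← sub_le_iff_le_add', le_div_iff₀ (by positivity)]
    linarith
  refine hfin.trans (add_le_add_left ?_ _)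
  calc 4 ^ n * (A * D) ≤ (1 + 8 / d) ^ 2 * (1 + r) ^ 2 * (A * D) :=
        mul_le_mul_of_nonneg_right h4 (mul_nonneg hA0.le hD)
    _ = _ := by ring

end Nash

/-! ### Positivity, local bounds and evolution laws of the solution. -/

/-- Comparison of two primitives on `(0, T]` whose initial values are attained along a sequence. -/
theorem sub_le_sub_of_deriv_le {w w' p p' : ℝ → ℝ} {T a b : ℝ} {s : ℕ → ℝ}
    (hw : ∀ t ∈ Ioc 0 T, HasDerivAt w (w' t) t) (hp : ∀ t ∈ Ioc 0 T, HasDerivAt p (p' t) t)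
    (h : ∀ t ∈ Ioc 0 T, p' t ≤ w' t) (hs0 : ∀ k, 0 < s k) (hs : Tendsto s atTop (𝓝 0))
    (hwa : Tendsto (fun k => w (s k)) atTop (𝓝 a)) (hpb : Tendsto (fun k => p (s k)) atTop (𝓝 b)) :
    ∀ t ∈ Ioc 0 T, a - b ≤ w t - p t := by
  have hd : ∀ t ∈ Ioc 0 T, HasDerivAt (fun t => w t - p t) (w' t - p' t) t :=
    fun t ht => (hw t ht).sub (hp t ht)
  have hmono : MonotoneOn (fun t => w t - p t) (Ioc 0 T) := by
    refine monotoneOn_of_deriv_nonneg (convex_Ioc 0 T)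
      (fun t ht => (hd t ht).continuousAt.continuousWithinAt)
      (fun t ht => (hd t (interior_subset ht)).differentiableAt.differentiableWithinAt)
      fun t ht => ?_
    rw [(hd t (interior_subset ht)).deriv]
    exact sub_nonneg.2 (h t (interior_subset ht))
  intro t ht
  refine le_of_tendsto (hwa.sub hpb) ?_
  filter_upwards [hs.eventually (gt_mem_nhds ht.1)] with k hk
  exact hmono ⟨hs0 k, hk.le.trans ht.2⟩ ht hk.le

namespace IsSolution

variable {H : Set ℝ} {J : ℝ → ℝ} {d : ℝ} {u₀ : ℝ → ℝ} {u : ℝ → ℝ → ℝ}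

theorem integrable_one (hu : IsSolution H J u₀ u) {t : ℝ} (ht : 0 ≤ t) : Integrable (u t) :=
  integrable_of_weighted (hu.integrable t ht)

theorem integrable_sub (hu : IsSolution H J u₀ u) {s t : ℝ} (hs : 0 ≤ s) (ht : 0 ≤ t) :
    Integrable (fun x => (1 + x ^ 2) * |u s x - u t x|) := by
  refine integrable_abs_weighted (((hu.integrable s hs).sub (hu.integrable t ht)).congr
    (ae_of_all _ fun x => ?_))
  simp only [Pi.sub_apply]
  ring

theorem continuousOn_integral (hu : IsSolution H J u₀ u) {ψ : ℝ → ℝ} {C : ℝ}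
    (hψ : AEStronglyMeasurable ψ volume) (hC : ∀ x, |ψ x| ≤ C * (1 + x ^ 2)) :
    ContinuousOn (fun t => ∫ x, ψ x * u t x) (Ici 0) := by
  intro t₀ ht₀
  rw [ContinuousWithinAt, tendsto_iff_norm_sub_tendsto_zero]
  refine squeeze_zero' (Eventually.of_forall fun _ => norm_nonneg _) ?_
    (by simpa using (hu.continuous t₀ ht₀).const_mul C)
  filter_upwards [self_mem_nhdsWithin] with t ht
  have i1 := integrable_weight_mul (hu.integrable t ht) hψ hC
  have i2 := integrable_weight_mul (hu.integrable t₀ ht₀) hψ hC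
  rw [← MeasureTheory.integral_sub i1 i2, ← integral_const_mul, Real.norm_eq_abs]
  refine abs_integral_le_integral_abs.trans
    (integral_mono (i1.sub i2).abs ((hu.integrable_sub ht ht₀).const_mul C) fun x => ?_)
  simp only [← mul_sub, abs_mul]
  rw [← mul_assoc]
  exact mul_le_mul_of_nonneg_right (hC x) (abs_nonneg _)

theorem exists_integral_abs_le (hu : IsSolution H J u₀ u) (T : ℝ) :
    ∃ B : ℝ, 0 ≤ B ∧ ∀ t ∈ Icc 0 T, ∫ x, |u t x| ≤ B := by
  have hc : ContinuousOn (fun t => ∫ x, |u t x|) (Icc 0 T) := by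
    refine ContinuousOn.mono (s := Ici 0) ?_ Icc_subset_Ici_self
    intro t₀ ht₀
    rw [ContinuousWithinAt, tendsto_iff_norm_sub_tendsto_zero]
    refine squeeze_zero' (Eventually.of_forall fun _ => norm_nonneg _) ?_ (hu.continuous t₀ ht₀)
    filter_upwards [self_mem_nhdsWithin] with t ht
    have i1 := (hu.integrable_one ht).abs
    have i2 := (hu.integrable_one ht₀).abs
    rw [← MeasureTheory.integral_sub i1 i2, Real.norm_eq_abs]
    refine abs_integral_le_integral_abs.trans
      (integral_mono (i1.sub i2).abs (hu.integrable_sub ht ht₀) fun x => ?_)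
    refine (abs_abs_sub_abs_le_abs_sub _ _).trans ?_
    nlinarith [abs_nonneg (u t x - u t₀ x), sq_nonneg x,
      mul_nonneg (sq_nonneg x) (abs_nonneg (u t x - u t₀ x))]
  obtain ⟨B, hB⟩ := isCompact_Icc.exists_bound_of_continuousOn hc
  exact ⟨max B 0, le_max_right _ _, fun t ht =>
    (le_abs_self _).trans ((hB t ht).trans (le_max_left _ _))⟩

/-- Continuity at `t = 0` is known only in the mean; a subsequence converging almost everywhere is
enough to start the pointwise integration in time. -/
theorem exists_seq_tendsto_initial (hu : IsSolution H J u₀ u) :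
    ∃ s : ℕ → ℝ, (∀ k, 0 < s k) ∧ Tendsto s atTop (𝓝 0) ∧
      ∀ᵐ x, Tendsto (fun k => u (s k) x) atTop (𝓝 (u₀ x)) := by
  set s : ℕ → ℝ := fun n => 1 / ((n : ℝ) + 1) with hs
  have hs0 : ∀ n, 0 < s n := fun n => by positivity
  have hst : Tendsto s atTop (𝓝 0) := tendsto_one_div_add_atTop_nhds_zero_nat
  have hsw : Tendsto s atTop (𝓝[Ici 0] 0) :=
    tendsto_nhdsWithin_iff.2 ⟨hst, Eventually.of_forall fun n => (hs0 n).le⟩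
  have hL : Tendsto (fun n => eLpNorm (u (s n) - u 0) 1 volume) atTop (𝓝 0) := by
    have h := ENNReal.tendsto_ofReal ((hu.continuous 0 le_rfl).comp hsw)
    rw [ENNReal.ofReal_zero] at h
    refine tendsto_of_tendsto_of_tendsto_of_le_of_le tendsto_const_nhds h (fun _ => zero_le)
      fun n => ?_
    have i1 := hu.integrable_one (hs0 n).le
    have i2 := hu.integrable_one le_rfl
    rw [eLpNorm_one_eq_lintegral_enorm, ← ofReal_integral_norm_eq_lintegral_enorm (i1.sub i2)]
    refine ENNReal.ofReal_le_ofReal (integral_mono (i1.sub i2).norm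
      (hu.integrable_sub (hs0 n).le le_rfl) fun x => ?_)
    simp only [Pi.sub_apply, Real.norm_eq_abs]
    nlinarith [mul_nonneg (sq_nonneg x) (abs_nonneg (u (s n) x - u 0 x))]
  obtain ⟨ns, hns, hlim⟩ := (tendstoInMeasure_of_tendsto_eLpNorm one_ne_zero
    (fun n => (hu.integrable_one (hs0 n).le).1) (hu.integrable_one le_rfl).1 hL).exists_seq_tendsto_ae
  refine ⟨s ∘ ns, fun k => hs0 _, hst.comp hns.tendsto_atTop, ?_⟩
  filter_upwards [hlim, hu.initial] with x hx h0
  rw [← h0]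
  exact hx

/-- The integrating factor removes the term `-u` and leaves a positivity-preserving operator. -/
theorem hasDerivAt_exp_mul (hu : IsSolution H J u₀ u) :
    ∀ᵐ x, x ∉ H → ∀ t, 0 < t →
      HasDerivAt (fun s => Real.exp s * u s x) (Real.exp t * smear J (u t) x) t := by
  filter_upwards [hu.equation] with x hx hxH t ht
  have h := (Real.hasDerivAt_exp t).mul (hx hxH t ht)
  rw [nonlocalOp_eq_smear_sub] at h
  exact h.congr_deriv (by ring)

/-- The derivative of `exp t * u t x` is at most `exp T * J 0` times a bound for the `L¹` norm on
`[0, T]`, uniformly in `x`, so the growth from the bounded datum is at most linear. -/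
theorem exists_abs_exp_mul_le (hJ : IsKernel J d) (hu₀ : IsInitialDatum H u₀)
    (hu : IsSolution H J u₀ u) {T : ℝ} (hT : 0 < T) :
    ∃ B : ℝ, 0 ≤ B ∧ ∀ᵐ x, ∀ t ∈ Ioc 0 T, |Real.exp t * u t x| ≤ B := by
  obtain ⟨B₁, hB₁, hB⟩ := hu.exists_integral_abs_le T
  obtain ⟨s, hs0, hs, hlim⟩ := hu.exists_seq_tendsto_initial
  have hJ0 := hJ.nonneg 0
  set K := Real.exp T * (J 0 * B₁) with hK
  have hK0 : 0 ≤ K := by positivity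
  set N := (eLpNorm u₀ ⊤ volume).toReal with hN
  have hN0 : 0 ≤ N := ENNReal.toReal_nonneg
  have hu₀N : ∀ᵐ x, |u₀ x| ≤ N := by
    have h := ae_le_eLpNormEssSup (f := u₀) (μ := volume)
    rw [← eLpNorm_exponent_top] at h
    filter_upwards [h] with x hx
    have := ENNReal.toReal_mono hu₀.memLp_top.2.ne hx
    rwa [toReal_enorm, Real.norm_eq_abs] at this
  refine ⟨N + K * T, by positivity, ?_⟩
  filter_upwards [hu.hasDerivAt_exp_mul, hu.zero_on_hole, hlim, hu₀N] with x hx hxH hxl hxN t ht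
  by_cases h : x ∈ H
  · rw [hxH h t ht.1]
    simp only [mul_zero, abs_zero]
    positivity
  · have hsm : ∀ t ∈ Ioc 0 T, |Real.exp t * smear J (u t) x| ≤ K := by
      intro t ht
      rw [abs_mul, abs_of_pos (Real.exp_pos t)]
      exact mul_le_mul (Real.exp_le_exp.2 ht.2)
        ((hJ.abs_smear_le (hu.integrable_one ht.1.le) x).trans
          (mul_le_mul_of_nonneg_left (hB t ⟨ht.1.le, ht.2⟩) hJ0)) (abs_nonneg _)
        (Real.exp_pos _).le
    have hw := fun t (ht : t ∈ Ioc 0 T) => hx h t ht.1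
    have hwa : Tendsto (fun k => Real.exp (s k) * u (s k) x) atTop (𝓝 (u₀ x)) := by
      have := ((Real.continuous_exp.tendsto 0).comp hs).mul hxl
      simpa using this
    have hlin (c t : ℝ) : HasDerivAt (fun t => c * t) c t := by
      simpa using (hasDerivAt_id t).const_mul c
    have hlinl (c : ℝ) : Tendsto (fun k => c * s k) atTop (𝓝 0) := by simpa using hs.const_mul c
    have hlow := sub_le_sub_of_deriv_le hw (fun t _ => hlin (-K) t)
      (fun t ht => (abs_le.1 (hsm t ht)).1) hs0 hs hwa (hlinl (-K)) t ht
    have hup := sub_le_sub_of_deriv_le (fun t _ => hlin K t) hw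
      (fun t ht => (abs_le.1 (hsm t ht)).2) hs0 hs (hlinl K) hwa t ht
    have hKt := mul_le_mul_of_nonneg_left ht.2 hK0
    obtain ⟨h1, h2⟩ := abs_le.1 hxN
    rw [abs_le]
    constructor <;> linarith

/-- Picard iteration on the lower bound: averaging preserves a bound constant in `x`, and each
integration in time improves `-B tⁿ/n!` to the next such term. The limit is 0. -/
theorem ae_nonneg_of_pos (hJ : IsKernel J d) (hu₀ : IsInitialDatum H u₀)
    (hu : IsSolution H J u₀ u) : ∀ᵐ x, ∀ t, 0 < t → 0 ≤ u t x := by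
  obtain ⟨s, hs0, hs, hlim⟩ := hu.exists_seq_tendsto_initial
  have main : ∀ T : ℝ, 0 < T → ∀ᵐ x, ∀ t ∈ Ioc 0 T, 0 ≤ u t x := by
    intro T hT
    obtain ⟨B, hB, hbd⟩ := exists_abs_exp_mul_le hJ hu₀ hu hT
    have hind : ∀ n : ℕ, ∀ᵐ x, ∀ t ∈ Ioc 0 T,
        -(B * (t ^ n / n.factorial)) ≤ Real.exp t * u t x := by
      intro n
      induction n with
      | zero =>
        filter_upwards [hbd] with x hx t ht
        simpa using (abs_le.1 (hx t ht)).1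
      | succ n ih =>
        filter_upwards [hu.hasDerivAt_exp_mul, hu.zero_on_hole, hlim, hu₀.nonneg]
          with x hx hxH hxl hx0 t ht
        by_cases h : x ∈ H
        · rw [hxH h t ht.1, mul_zero, neg_nonpos]
          have := ht.1.le
          positivity
        · have hw := fun t (ht : t ∈ Ioc 0 T) => hx h t ht.1
          have hwa : Tendsto (fun k => Real.exp (s k) * u (s k) x) atTop (𝓝 (u₀ x)) := by
            have := ((Real.continuous_exp.tendsto 0).comp hs).mul hxl
            simpa using this
          have hp : ∀ t ∈ Ioc 0 T, HasDerivAt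
              (fun t : ℝ => -(B * (t ^ (n + 1) / (n + 1).factorial)))
              (-(B * (t ^ n / n.factorial))) t := by
            intro t _
            have h1 := ((hasDerivAt_pow (n + 1) t).div_const ((n + 1).factorial : ℝ)).const_mul B
            refine h1.neg.congr_deriv ?_
            have : (n.factorial : ℝ) ≠ 0 := by positivity
            rw [Nat.factorial_succ]
            push_cast
            field_simp
          have hpb : Tendsto (fun k => -(B * (s k ^ (n + 1) / ((n + 1).factorial : ℝ)))) atTop
              (𝓝 0) := by
            simpa using (((hs.pow (n + 1)).div_const ((n + 1).factorial : ℝ)).const_mul B).neg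
          have hle : ∀ t ∈ Ioc 0 T, -(B * (t ^ n / n.factorial)) ≤
              Real.exp t * smear J (u t) x := by
            intro t ht
            rw [← IsKernel.smear_const_mul, ← hJ.smear_const (-(B * (t ^ n / n.factorial))) x]
            refine hJ.smear_mono (locallyIntegrable_const _)
              ((hu.integrable_one ht.1.le).const_mul _).locallyIntegrable ?_
            filter_upwards [ih] with y hy _ using hy t ht
          have := sub_le_sub_of_deriv_le hw hp hle hs0 hs hwa hpb t ht
          linarith
    filter_upwards [ae_all_iff.2 hind] with x hx t ht
    have hl : Tendsto (fun n : ℕ => -(B * (t ^ n / n.factorial))) atTop (𝓝 0) := by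
      simpa using ((FloorSemiring.tendsto_pow_div_factorial_atTop t).const_mul B).neg
    have := le_of_tendsto hl (Eventually.of_forall fun n => hx n t ht)
    exact nonneg_of_mul_nonneg_right this (Real.exp_pos t)
  have hall : ∀ᵐ x, ∀ n : ℕ, ∀ t ∈ Ioc 0 ((n : ℝ) + 1), 0 ≤ u t x :=
    ae_all_iff.2 fun n => main _ (by positivity)
  filter_upwards [hall] with x hx t ht
  obtain ⟨n, hn⟩ := exists_nat_ge t
  exact hx n t ⟨ht, by linarith⟩

theorem ae_nonneg (hJ : IsKernel J d) (hu₀ : IsInitialDatum H u₀)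
    (hu : IsSolution H J u₀ u) {t : ℝ} (ht : 0 ≤ t) : ∀ᵐ x, 0 ≤ u t x := by
  rcases ht.eq_or_lt with rfl | ht
  · filter_upwards [hu.initial, hu₀.nonneg] with x h1 h2
    rwa [h1]
  · filter_upwards [ae_nonneg_of_pos hJ hu₀ hu] with x hx using hx t ht

theorem ae_zero_on_hole (hu₀ : IsInitialDatum H u₀) (hu : IsSolution H J u₀ u) {t : ℝ}
    (ht : 0 ≤ t) : ∀ᵐ x, x ∈ H → u t x = 0 := by
  rcases ht.eq_or_lt with rfl | ht
  · filter_upwards [hu.initial, hu₀.zero_on_hole] with x h1 h2 hx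
    rw [h1, h2 hx]
  · filter_upwards [hu.zero_on_hole] with x hx hxH using hx hxH t ht

theorem exists_le_of_le (hJ : IsKernel J d) (hu₀ : IsInitialDatum H u₀)
    (hu : IsSolution H J u₀ u) {T : ℝ} (hT : 0 < T) :
    ∃ B : ℝ, 0 ≤ B ∧ ∀ᵐ x, ∀ t ∈ Ioc 0 T, |u t x| ≤ B := by
  obtain ⟨B, hB, h⟩ := exists_abs_exp_mul_le hJ hu₀ hu hT
  refine ⟨B, hB, ?_⟩
  filter_upwards [h] with x hx t ht
  have h1 := hx t ht
  rw [abs_mul, abs_of_pos (Real.exp_pos t)] at h1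
  have h2 := Real.one_le_exp ht.1.le
  nlinarith [abs_nonneg (u t x)]

theorem memLp_top (hJ : IsKernel J d) (hu₀ : IsInitialDatum H u₀)
    (hu : IsSolution H J u₀ u) {t : ℝ} (ht : 0 ≤ t) : MemLp (u t) ⊤ volume := by
  rcases ht.eq_or_lt with rfl | ht
  · exact (memLp_congr_ae hu.initial).2 hu₀.memLp_top
  · obtain ⟨B, -, h⟩ := exists_le_of_le hJ hu₀ hu ht
    refine memLp_top_of_bound (hu.integrable_one ht.le).1 B ?_
    filter_upwards [h] with x hx using hx t ⟨ht, le_rfl⟩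

theorem exp_mul_mono (hJ : IsKernel J d) (hu₀ : IsInitialDatum H u₀) (hu : IsSolution H J u₀ u) :
    ∀ᵐ x, MonotoneOn (fun t => Real.exp t * u t x) (Ioi 0) := by
  filter_upwards [hu.hasDerivAt_exp_mul, hu.zero_on_hole] with x hx hxH
  by_cases h : x ∈ H
  · intro s hs t ht _
    simp [hxH h s hs, hxH h t ht]
  · refine monotoneOn_of_deriv_nonneg (convex_Ioi 0)
      (fun t ht => (hx h t ht).continuousAt.continuousWithinAt)
      (fun t ht => (hx h t (interior_subset ht)).differentiableAt.differentiableWithinAt)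
      fun t ht => ?_
    have ht' := interior_subset ht
    rw [(hx h t ht').deriv]
    exact mul_nonneg (Real.exp_pos t).le (hJ.smear_nonneg (ae_nonneg hJ hu₀ hu (le_of_lt ht')) x)

/-- All earlier profiles are dominated by a single later one, which supplies the integrable majorant
for differentiating under the integral. -/
theorem ae_le_exp_mul (hJ : IsKernel J d) (hu₀ : IsInitialDatum H u₀) (hu : IsSolution H J u₀ u) :
    ∀ᵐ x, ∀ s t, 0 < s → s ≤ t → u s x ≤ Real.exp t * u t x := by
  filter_upwards [exp_mul_mono hJ hu₀ hu, ae_nonneg_of_pos hJ hu₀ hu] with x hx h0 s t hs hst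
  refine le_trans ?_ (hx hs (hs.trans_le hst) hst)
  exact le_mul_of_one_le_left (h0 s hs) (Real.one_le_exp hs.le)

/-- On a bounded time interval the time derivative is dominated by a fixed function of `x`. -/
theorem abs_nonlocalOp_le (hJ : IsKernel J d) (hu₀ : IsInitialDatum H u₀)
    (hu : IsSolution H J u₀ u) : ∀ᵐ x, ∀ s t, 0 < s → s ≤ t →
      |nonlocalOp J (u s) x| ≤ Real.exp t * (smear J (u t) x + u t x) := by
  filter_upwards [ae_le_exp_mul hJ hu₀ hu, ae_nonneg_of_pos hJ hu₀ hu] with x hx h0 s t hs hst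
  have h1 := hJ.smear_nonneg (ae_nonneg hJ hu₀ hu hs.le) x
  have h2 : smear J (u s) x ≤ Real.exp t * smear J (u t) x := by
    rw [← IsKernel.smear_const_mul]
    refine hJ.smear_mono (hu.integrable_one hs.le).locallyIntegrable
      ((hu.integrable_one (hs.le.trans hst)).const_mul _).locallyIntegrable ?_
    filter_upwards [ae_le_exp_mul hJ hu₀ hu] with y hy _ using hy s t hs hst
  have h3 := hx s t hs hst
  have h4 := h0 s hs
  rw [nonlocalOp_eq_smear_sub, abs_le]
  constructor <;> nlinarith

/-- Evolution of the integral of the solution against a weight vanishing in the hole. -/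
theorem hasDerivAt_integral_mul (hJ : IsKernel J d) (hu₀ : IsInitialDatum H u₀)
    (hu : IsSolution H J u₀ u) {ψ : ℝ → ℝ} {C : ℝ}
    (hψ : AEStronglyMeasurable ψ volume) (hC : ∀ x, |ψ x| ≤ C * (1 + x ^ 2))
    (hψH : ∀ x ∈ H, ψ x = 0) {t : ℝ} (ht : 0 < t) :
    HasDerivAt (fun s => ∫ x, ψ x * u s x) (∫ x, u t x * nonlocalOp J ψ x) t := by
  have h2t : (0 : ℝ) ≤ 2 * t := by positivity
  have hC0 : 0 ≤ C := by simpa using (abs_nonneg _).trans (hC 0)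
  have hwt := hu.integrable t ht.le
  have hw2t := hu.integrable (2 * t) h2t
  have iψu := integrable_weight_mul hwt hψ hC
  have iψs := integrable_mul_smear hJ hwt hψ hC
  have hone : AEStronglyMeasurable (fun x : ℝ => 1 + x ^ 2) volume :=
    Continuous.aestronglyMeasurable (by fun_prop)
  have hone' : ∀ x : ℝ, |1 + x ^ 2| ≤ 1 * (1 + x ^ 2) := fun x => by
    rw [one_mul, abs_of_nonneg (by positivity)]
  -- The times `s` in `(0, 2t)` form a neighbourhood of `t`, and the profile at time `2t` dominates
  -- them all.
  have key := hasDerivAt_integral_of_dominated_loc_of_deriv_le (μ := volume) (𝕜 := ℝ)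
    (F := fun s x => ψ x * u s x) (F' := fun s x => ψ x * nonlocalOp J (u s) x)
    (bound := fun x => C * Real.exp (2 * t) *
      ((1 + x ^ 2) * smear J (u (2 * t)) x + (1 + x ^ 2) * u (2 * t) x))
    (s := Ioo 0 (2 * t)) (x₀ := t) (Ioo_mem_nhds ht (by linarith)) ?_ iψu ?_ ?_ ?_ ?_
  · refine key.2.congr_deriv ?_
    simp only [nonlocalOp_eq_smear_sub, mul_sub]
    rw [MeasureTheory.integral_sub iψs iψu, integral_mul_smear_comm hJ hwt hψ hC,
      MeasureTheory.integral_sub (integrable_smear_mul hJ hwt hψ hC)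
        (by simpa only [mul_comm] using iψu)]
    simp only [mul_comm]
  · filter_upwards [lt_mem_nhds ht] with s hs
    exact (integrable_weight_mul (hu.integrable s hs.le) hψ hC).1
  · simp only [nonlocalOp_eq_smear_sub, mul_sub]
    exact (iψs.sub iψu).1
  · filter_upwards [abs_nonlocalOp_le hJ hu₀ hu] with x hx s hs
    rw [Real.norm_eq_abs, abs_mul]
    refine (mul_le_mul (hC x) (hx s (2 * t) hs.1 hs.2.le) (abs_nonneg _) (by positivity)).trans
      (le_of_eq (by ring))
  · exact ((integrable_mul_smear hJ hw2t hone hone').add hw2t).const_mul _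
  · filter_upwards [hu.equation] with x hx s hs
    by_cases h : x ∈ H
    · simpa [hψH x h] using hasDerivAt_const s (0 : ℝ)
    · exact (hx h s hs.1).const_mul _

theorem memLp_two (hJ : IsKernel J d) (hu₀ : IsInitialDatum H u₀)
    (hu : IsSolution H J u₀ u) {t : ℝ} (ht : 0 < t) : MemLp (u t) 2 volume := by
  obtain ⟨B, -, h⟩ := exists_le_of_le hJ hu₀ hu ht
  refine (memLp_two_iff_integrable_sq (hu.integrable_one ht.le).1).2 ?_
  simp only [sq]
  refine (hu.integrable_one ht.le).mul_bdd (c := B) (hu.integrable_one ht.le).1 ?_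
  filter_upwards [h] with x hx using hx t ⟨ht, le_rfl⟩

/-- Dissipation of the `L²` norm. -/
theorem hasDerivAt_energy (hJ : IsKernel J d) (hu₀ : IsInitialDatum H u₀)
    (hu : IsSolution H J u₀ u) {t : ℝ} (ht : 0 < t) :
    HasDerivAt (fun s => ∫ x, u s x ^ 2)
      (-2 * ((∫ x, u t x ^ 2) - ∫ x, u t x * smear J (u t) x)) t := by
  have h2t : (0 : ℝ) < 2 * t := by positivity
  obtain ⟨B, hB0, hB⟩ := exists_le_of_le hJ hu₀ hu h2t
  have i1 := integrable_smear hJ (hu.integrable t ht.le)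
  have iu := hu.integrable_one ht.le
  have isq : Integrable fun x => u t x ^ 2 := (memLp_two hJ hu₀ hu ht).integrable_sq
  have ius : Integrable fun x => u t x * smear J (u t) x := by
    refine i1.bdd_mul (c := B) iu.1 ?_
    filter_upwards [hB] with x hx using hx t ⟨ht, by linarith⟩
  have key := hasDerivAt_integral_of_dominated_loc_of_deriv_le (μ := volume) (𝕜 := ℝ)
    (F := fun s x => u s x ^ 2) (F' := fun s x => 2 * (u s x * nonlocalOp J (u s) x))
    (bound := fun x => 2 * B * Real.exp (2 * t) * (smear J (u (2 * t)) x + u (2 * t) x))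
    (s := Ioo 0 (2 * t)) (x₀ := t) (Ioo_mem_nhds ht (by linarith)) ?_ isq ?_ ?_ ?_ ?_
  · refine key.2.congr_deriv ?_
    simp only [nonlocalOp_eq_smear_sub, mul_sub, ← sq]
    rw [MeasureTheory.integral_sub (ius.const_mul 2) (isq.const_mul 2), integral_const_mul,
      integral_const_mul]
    ring
  · filter_upwards [lt_mem_nhds ht] with s hs
    exact (memLp_two hJ hu₀ hu hs).integrable_sq.1
  · simp only [nonlocalOp_eq_smear_sub, mul_sub, ← sq]
    exact ((ius.const_mul 2).sub (isq.const_mul 2)).1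
  · filter_upwards [abs_nonlocalOp_le hJ hu₀ hu, hB] with x hx hxB s hs
    rw [Real.norm_eq_abs, abs_mul, abs_mul, abs_two]
    refine (mul_le_mul_of_nonneg_left (mul_le_mul (hxB s ⟨hs.1, hs.2.le⟩)
      (hx s (2 * t) hs.1 hs.2.le) (abs_nonneg _) hB0) zero_le_two).trans (le_of_eq (by ring))
  · exact ((integrable_smear hJ (hu.integrable _ h2t.le)).add
      (hu.integrable_one h2t.le)).const_mul _
  · filter_upwards [hu.equation, hu.zero_on_hole] with x hx hx0 s hs
    by_cases h : x ∈ H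
    · rw [hx0 h s hs.1]
      have he : (fun r => u r x ^ 2) =ᶠ[𝓝 s] fun _ => 0 := by
        filter_upwards [lt_mem_nhds hs.1] with r hr
        rw [hx0 h r hr]; simp
      simpa using (hasDerivAt_const s (0 : ℝ)).congr_of_eventuallyEq he
    · refine ((hx h s hs.1).pow 2).congr_deriv ?_
      push_cast
      ring

end IsSolution

/-! ### Barrier, interpolation of the mass, and a differential inequality. -/

theorem abs_le_one_add_sq (x : ℝ) : |x| ≤ 1 + x ^ 2 := by
  rw [abs_le]
  constructor <;> nlinarith [sq_nonneg (x - 1), sq_nonneg (x + 1)]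

/-- A positive weight of linear growth, vanishing in the hole, which is a supersolution of the
stationary problem. -/
theorem exists_barrier {H : Set ℝ} {J : ℝ → ℝ} {d : ℝ} (hH : IsHole H) (hJ : IsKernel J d) :
    ∃ A > 0, ∀ x ∉ H, nonlocalOp J (Hᶜ.indicator fun y => |y| + A) x ≤ 0 := by
  obtain ⟨c, hc, hcH⟩ := hJ.exists_le_smear_hole hH
  have hd := hJ.d_pos
  have hmH := hH.isOpen.measurableSet
  -- For `|x| ≤ d` averaging raises `|y|` by at most `d`, while the hole removes at least `A * c`;
  -- `A = d / c` balances the two. For `|x| ≥ d` averaging fixes `|y|` and the hole can only help.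
  refine ⟨d / c, by positivity, fun x hx => ?_⟩
  set A := d / c with hA
  have hA0 : 0 < A := by positivity
  have hAc : A * c = d := div_mul_cancel₀ _ hc.ne'
  have l1 : LocallyIntegrable (fun y : ℝ => |y|) := continuous_abs.locallyIntegrable
  have l2 : LocallyIntegrable (H.indicator fun _ : ℝ => (1 : ℝ)) :=
    (locallyIntegrable_const (1 : ℝ)).indicator hmH
  have l3 : LocallyIntegrable fun y => (-A) * H.indicator (fun _ : ℝ => (1 : ℝ)) y :=
    l2.smul (-A)
  have l4 : LocallyIntegrable fun _ : ℝ => A := locallyIntegrable_const A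
  have l5 : LocallyIntegrable fun y => A + (-A) * H.indicator (fun _ : ℝ => (1 : ℝ)) y := l4.add l3
  have l6 : LocallyIntegrable (Hᶜ.indicator fun y : ℝ => |y| + A) :=
    (l1.add l4).indicator hmH.compl
  have h1 : smear J (Hᶜ.indicator fun y => |y| + A) x ≤
      smear J (fun y => |y| + (A + (-A) * H.indicator (fun _ => 1) y)) x := by
    refine hJ.smear_mono l6 (l1.add l5) (ae_of_all _ fun y _ => ?_)
    by_cases hy : y ∈ H
    · simp [hy]
    · simp [hy]
  rw [hJ.smear_add l1 l5, hJ.smear_add l4 l3, hJ.smear_const, IsKernel.smear_const_mul] at h1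
  rw [nonlocalOp_eq_smear_sub, indicator_of_mem (show x ∈ Hᶜ from hx)]
  rcases le_total |x| d with hxd | hxd
  · have h2 := hJ.smear_abs_le x
    have h3 := mul_le_mul_of_nonneg_left (hcH x hxd) hA0.le
    linarith
  · have h2 := hJ.smear_abs hxd
    have h3 := mul_nonneg hA0.le (hJ.smear_nonneg (f := H.indicator fun _ => 1)
      (ae_of_all _ fun y => indicator_nonneg (fun _ _ => zero_le_one) y) x)
    linarith

theorem nonlocalOp_indicator_sq_le {H : Set ℝ} {J : ℝ → ℝ} {d : ℝ} (hH : IsHole H)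
    (hJ : IsKernel J d) {x : ℝ} (hx : x ∉ H) :
    nonlocalOp J (Hᶜ.indicator fun y => y ^ 2) x ≤ d ^ 2 := by
  have l : LocallyIntegrable fun y : ℝ => y ^ 2 := (continuous_pow 2).locallyIntegrable
  have h1 : smear J (Hᶜ.indicator fun y => y ^ 2) x ≤ smear J (fun y => y ^ 2) x :=
    hJ.smear_mono (l.indicator hH.isOpen.measurableSet.compl) l
      (ae_of_all _ fun y _ => indicator_le_self' (fun _ _ => sq_nonneg _) y)
  rw [nonlocalOp_eq_smear_sub, indicator_of_mem (show x ∈ Hᶜ from hx)]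
  linarith [hJ.smear_sq_le x]

/-- Control of the mass by the behaviour near the origin and the first momentum. -/
theorem integral_le_split {f g : ℝ → ℝ} {a R : ℝ} (hf : Integrable fun x => (1 + x ^ 2) * f x)
    (h0 : ∀ᵐ x, 0 ≤ f x) (hg : Integrable g) (hg0 : ∀ x, 0 ≤ g x) (hR : 0 < R)
    (hfg : ∀ᵐ x, f x ≤ a + g x) :
    ∫ x, f x ≤ 2 * R * a + (∫ x, g x) + (∫ x, f x * |x|) / R := by
  have i1 : Integrable ((Icc (-R) R).indicator fun _ => a) :=
    (integrable_indicator_iff measurableSet_Icc).2 (integrableOn_const (by simp [Real.volume_Icc]))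
  have i3 : Integrable fun x => f x * |x| := by
    simpa only [mul_comm] using integrable_weight_mul (ψ := fun x => |x|) (C := 1) hf
      continuous_abs.aestronglyMeasurable fun x => by
        rw [abs_abs, one_mul]; exact abs_le_one_add_sq x
  have e1 : ∫ x, (Icc (-R) R).indicator (fun _ => a) x = 2 * R * a := by
    rw [integral_indicator measurableSet_Icc, setIntegral_const, Measure.real, Real.volume_Icc,
      ENNReal.toReal_ofReal (by linarith), smul_eq_mul]
    ring
  have i12 : Integrable fun x => (Icc (-R) R).indicator (fun _ => a) x + g x := i1.add hg
  rw [← e1, ← integral_add i1 hg, ← integral_div, ← integral_add i12 (i3.div_const R)]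
  refine integral_mono_ae (integrable_of_weighted hf) (i12.add (i3.div_const R)) ?_
  filter_upwards [h0, hfg] with x hx0 hx
  by_cases h : x ∈ Icc (-R) R
  · rw [indicator_of_mem h]
    have : 0 ≤ f x * |x| / R := by positivity
    linarith
  · rw [indicator_of_notMem h]
    have h1 : R ≤ |x| := by
      by_contra h2
      exact h (abs_le.1 (not_le.1 h2).le)
    have h2 : f x ≤ f x * |x| / R := by
      rw [le_div_iff₀ hR]
      exact mul_le_mul_of_nonneg_left h1 hx0
    linarith [hg0 x]

/-- The radius `R = S^(-1/2)` makes `2RS` and `K/R` both of order `S^(1/2)`. -/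
theorem integral_le_sup_rpow {f : ℝ → ℝ} {S K : ℝ} (hf : Integrable fun x => (1 + x ^ 2) * f x)
    (h0 : ∀ᵐ x, 0 ≤ f x) (hS : 0 ≤ S) (hfS : ∀ᵐ x, f x ≤ S) (hK : ∫ x, f x * |x| ≤ K) :
    ∫ x, f x ≤ (2 + K) * S ^ (1 / 2 : ℝ) := by
  rw [← Real.sqrt_eq_rpow]
  rcases hS.eq_or_lt with rfl | hS
  · simpa using integral_nonpos_of_ae hfS
  · have hs := Real.sqrt_pos.2 hS
    have h := integral_le_split (g := fun _ => 0) (R := (√S)⁻¹) hf h0 (integrable_zero _ _ _)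
      (fun _ => le_rfl) (by positivity) (by simpa using hfS)
    simp only [integral_zero, div_inv_eq_mul, add_zero] at h
    have e : 2 * (√S)⁻¹ * S = 2 * √S := by
      nth_rewrite 2 [← Real.mul_self_sqrt hS.le]
      field_simp
    rw [e] at h
    nlinarith

/-- With `e` the cube root of the energy, use `f ≤ e²/2 + f²/(2e²)` inside the radius `R = 1/e`; all
three contributions are then of order `e`. -/
theorem integral_le_energy_rpow {f : ℝ → ℝ} {K : ℝ} (hf : Integrable fun x => (1 + x ^ 2) * f x)
    (h0 : ∀ᵐ x, 0 ≤ f x) (h2 : MemLp f 2 volume) (hK : ∫ x, f x * |x| ≤ K) :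
    ∫ x, f x ≤ (2 + K) * (∫ x, f x ^ 2) ^ (1 / 3 : ℝ) := by
  have i2 : Integrable fun x => f x ^ 2 := h2.integrable_sq
  set E := ∫ x, f x ^ 2 with hE
  have hE0 : 0 ≤ E := integral_nonneg fun x => sq_nonneg _
  rcases hE0.eq_or_lt with hz | hE0
  · have hz' := (integral_eq_zero_iff_of_nonneg (fun x => sq_nonneg (f x)) i2).1 (hE ▸ hz.symm)
    have : ∫ x, f x = 0 := integral_eq_zero_of_ae (by
      filter_upwards [hz'] with x hx
      simpa using hx)
    rw [this, ← hz]
    simp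
  · set e := E ^ (1 / 3 : ℝ) with he
    have he0 : 0 < e := Real.rpow_pos_of_pos hE0 _
    have hE3 : E = e ^ 3 := by
      rw [he, ← Real.rpow_natCast, ← Real.rpow_mul hE0.le]
      norm_num
    have h := integral_le_split (g := fun x => f x ^ 2 / (2 * e ^ 2)) (a := e ^ 2 / 2) (R := e⁻¹)
      hf h0 (i2.div_const _) (fun _ => by positivity) (by positivity)
      (ae_of_all _ fun x => by
        rw [← sub_nonneg]
        have : e ^ 2 / 2 + f x ^ 2 / (2 * e ^ 2) - f x = (f x - e ^ 2) ^ 2 / (2 * e ^ 2) := by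
          field_simp
          ring
        rw [this]
        positivity)
    rw [integral_div, ← hE, hE3, div_inv_eq_mul] at h
    have e1 : 2 * e⁻¹ * (e ^ 2 / 2) + e ^ 3 / (2 * e ^ 2) = 3 / 2 * e := by
      field_simp
      ring
    rw [e1] at h
    nlinarith

/-- Decay of the solutions of the differential inequality `E' ≤ -(2 / L) E ^ (5 / 3)`. -/
theorem rpow_third_le_of_deriv {E D : ℝ → ℝ} {L : ℝ} (hL : 0 < L)
    (hE : ∀ t, 0 < t → HasDerivAt E (-2 * D t) t) (hE0 : ∀ t, 0 ≤ E t)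
    (hD : ∀ t, 0 < t → E t ^ (5 / 3 : ℝ) ≤ L * D t) {t : ℝ} (ht : 0 < t) :
    E t ^ (1 / 3 : ℝ) ≤ (4 / (3 * L)) ^ (-(1 / 2) : ℝ) * t ^ (-(1 / 2) : ℝ) := by
  have hD0 : ∀ t, 0 < t → 0 ≤ D t := fun t ht =>
    nonneg_of_mul_nonneg_right ((Real.rpow_nonneg (hE0 t) _).trans (hD t ht)) hL
  have hanti : AntitoneOn E (Ioi 0) := by
    refine antitoneOn_of_deriv_nonpos (convex_Ioi 0)
      (fun t ht => (hE t ht).continuousAt.continuousWithinAt)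
      (fun t ht => (hE t (interior_subset ht)).differentiableAt.differentiableWithinAt)
      fun t ht => ?_
    rw [(hE t (interior_subset ht)).deriv]
    linarith [hD0 t (interior_subset ht)]
  rcases (hE0 t).eq_or_lt with hz | hpos
  · rw [← hz, Real.zero_rpow (by norm_num)]
    positivity
  · have hpos' : ∀ s ∈ Ioc 0 t, 0 < E s := fun s hs => hpos.trans_le (hanti hs.1 ht hs.2)
    -- The power `E^(-2/3)` linearises the inequality: its derivative is `(4/3) D E^(-5/3) ≥
    -- 4/(3L)`.
    have hder : ∀ s ∈ Ioc 0 t, HasDerivAt (fun s => E s ^ (-(2 / 3) : ℝ) - 4 / (3 * L) * s)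
        (4 / 3 * (D s * E s ^ (-(5 / 3) : ℝ)) - 4 / (3 * L)) s := by
      intro s hs
      have h1 := (hE s hs.1).rpow_const (p := (-(2 / 3) : ℝ)) (Or.inl (hpos' s hs).ne')
      have h2 := (hasDerivAt_id s).const_mul (4 / (3 * L))
      refine (h1.sub h2).congr_deriv ?_
      rw [show (-(2 / 3) - 1 : ℝ) = -(5 / 3) by norm_num]
      ring
    have hmono : MonotoneOn (fun s => E s ^ (-(2 / 3) : ℝ) - 4 / (3 * L) * s) (Ioc 0 t) := by
      refine monotoneOn_of_deriv_nonneg (convex_Ioc 0 t)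
        (fun s hs => (hder s hs).continuousAt.continuousWithinAt)
        (fun s hs => (hder s (interior_subset hs)).differentiableAt.differentiableWithinAt)
        fun s hs => ?_
      have hs' := interior_subset hs
      rw [(hder s hs').deriv, Real.rpow_neg (hE0 s), ← div_eq_mul_inv]
      have h1 : 1 / L ≤ D s / E s ^ (5 / 3 : ℝ) := by
        rw [div_le_div_iff₀ hL (Real.rpow_pos_of_pos (hpos' s hs') _)]
        linarith [hD s hs'.1]
      have h2 : 4 / (3 * L) = 4 / 3 * (1 / L) := by
        field_simp
      rw [h2]
      linarith
    have hy : 4 / (3 * L) * t ≤ E t ^ (-(2 / 3) : ℝ) := by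
      -- Nothing is assumed at time 0, so the comparison starts at a small `s > 0`, dropping the
      -- nonnegative term `E s ^ (-2/3)` and letting `ε` absorb the rest.
      refine le_of_forall_pos_le_add fun ε hε => ?_
      set s := min t (ε / (4 / (3 * L)))
      have hs0 : 0 < s := lt_min ht (by positivity)
      have h1 := hmono ⟨hs0, min_le_left _ _⟩ ⟨ht, le_rfl⟩ (min_le_left _ _)
      have h2 : 4 / (3 * L) * s ≤ ε := by
        have := min_le_right t (ε / (4 / (3 * L)))
        rw [le_div_iff₀ (by positivity)] at this
        rwa [mul_comm]
      have h3 := Real.rpow_nonneg (hE0 s) (-(2 / 3))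
      simp only at h1
      linarith
    have h := Real.rpow_le_rpow_of_nonpos (z := (-(1 / 2) : ℝ)) (by positivity) hy (by norm_num)
    rw [← Real.rpow_mul (hE0 t), Real.mul_rpow (by positivity) ht.le] at h
    norm_num at h ⊢
    exact h

/-! ### Momentum bounds, decay of the mass, conserved quantities. -/

namespace IsSolution

variable {H : Set ℝ} {J : ℝ → ℝ} {d : ℝ} {u₀ : ℝ → ℝ} {u : ℝ → ℝ → ℝ}

theorem integrable_mul_abs (hu : IsSolution H J u₀ u) {t : ℝ} (ht : 0 ≤ t) :
    Integrable fun x => u t x * |x| := by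
  simpa only [mul_comm] using integrable_weight_mul (ψ := fun x => |x|) (C := 1)
    (hu.integrable t ht) continuous_abs.aestronglyMeasurable fun x => by
      rw [abs_abs, one_mul]; exact abs_le_one_add_sq x

theorem mass_nonneg (hJ : IsKernel J d) (hu₀ : IsInitialDatum H u₀)
    (hu : IsSolution H J u₀ u) {t : ℝ} (ht : 0 ≤ t) : 0 ≤ mass u t :=
  integral_nonneg_of_ae (ae_nonneg hJ hu₀ hu ht)

/-- The integral against the barrier is nonincreasing; as the solution vanishes in the hole, it
equals `M₁ + A M`, a sum of nonnegative terms. -/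
theorem exists_mass_firstMomentum_le (hH : IsHole H) (hJ : IsKernel J d)
    (hu₀ : IsInitialDatum H u₀) (hu : IsSolution H J u₀ u) :
    ∃ K : ℝ, 0 ≤ K ∧ ∀ t, 0 ≤ t → mass u t ≤ K ∧ firstMomentum u t ≤ K := by
  obtain ⟨A, hA, hbar⟩ := exists_barrier hH hJ
  set ψ := Hᶜ.indicator fun y : ℝ => |y| + A with hψdef
  have hψ : AEStronglyMeasurable ψ volume :=
    (by fun_prop : Continuous fun y : ℝ => |y| + A).aestronglyMeasurable.indicator
      hH.isOpen.measurableSet.compl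
  have hC : ∀ x, |ψ x| ≤ (1 + A) * (1 + x ^ 2) := by
    intro x
    have h1 := abs_le_one_add_sq x
    have h2 : 0 ≤ A * x ^ 2 := by positivity
    by_cases hx : x ∈ H
    · simp only [hψdef, indicator_of_notMem (notMem_compl_iff.2 hx), abs_zero]
      positivity
    · simp only [hψdef, indicator_of_mem (show x ∈ Hᶜ from hx)]
      rw [abs_of_nonneg (by positivity)]
      nlinarith
  have hψH : ∀ x ∈ H, ψ x = 0 := fun x hx => indicator_of_notMem (notMem_compl_iff.2 hx) _
  have hder := fun t (ht : 0 < t) => hasDerivAt_integral_mul hJ hu₀ hu hψ hC hψH ht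
  have hanti : AntitoneOn (fun t => ∫ x, ψ x * u t x) (Ici 0) := by
    refine antitoneOn_of_deriv_nonpos (convex_Ici 0) (hu.continuousOn_integral hψ hC) ?_ ?_
    · rw [interior_Ici]
      exact fun t ht => (hder t ht).differentiableAt.differentiableWithinAt
    · rw [interior_Ici]
      intro t ht
      rw [(hder t ht).deriv]
      refine integral_nonpos_of_ae ?_
      filter_upwards [ae_nonneg_of_pos hJ hu₀ hu, hu.zero_on_hole] with x h0 hz
      by_cases hx : x ∈ H
      · simp [hz hx t ht]
      · exact mul_nonpos_of_nonneg_of_nonpos (h0 t ht) (hbar x hx)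
  set W := ∫ x, ψ x * u 0 x
  have hW : ∀ t, 0 ≤ t → firstMomentum u t + A * mass u t ≤ W := by
    intro t ht
    refine le_trans (le_of_eq ?_) (hanti (mem_Ici.2 le_rfl) ht ht)
    unfold firstMomentum mass
    rw [← integral_const_mul,
      ← integral_add (hu.integrable_mul_abs ht) ((hu.integrable_one ht).const_mul A)]
    refine integral_congr_ae ?_
    filter_upwards [ae_zero_on_hole hu₀ hu ht] with x hx
    by_cases h : x ∈ H
    · simp [hx h]
    · simp only [hψdef, indicator_of_mem (show x ∈ Hᶜ from h)]
      ring
  have hF0 : ∀ t, 0 ≤ t → 0 ≤ firstMomentum u t := fun t ht => integral_nonneg_of_ae (by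
    filter_upwards [ae_nonneg hJ hu₀ hu ht] with x hx using mul_nonneg hx (abs_nonneg x))
  have hW0 : 0 ≤ W := by
    linarith [hW 0 le_rfl, hF0 0 le_rfl, mul_nonneg hA.le (mass_nonneg hJ hu₀ hu le_rfl)]
  refine ⟨W + W / A, by positivity, fun t ht => ⟨?_, ?_⟩⟩
  · have : mass u t ≤ W / A := by
      rw [le_div_iff₀ hA]
      linarith [hW t ht, hF0 t ht]
    linarith
  · have : 0 ≤ W / A := by positivity
    linarith [hW t ht, mul_nonneg hA.le (mass_nonneg hJ hu₀ hu ht)]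

theorem exists_mass_le_supNorm (hH : IsHole H) (hJ : IsKernel J d)
    (hu₀ : IsInitialDatum H u₀) (hu : IsSolution H J u₀ u) :
    ∃ K : ℝ, 0 < K ∧ ∀ t, 0 ≤ t → mass u t ≤ K * supNorm (u t) ^ (1 / 2 : ℝ) := by
  obtain ⟨K, hK, hb⟩ := exists_mass_firstMomentum_le hH hJ hu₀ hu
  refine ⟨2 + K, by positivity, fun t ht => ?_⟩
  refine integral_le_sup_rpow (hu.integrable t ht) (ae_nonneg hJ hu₀ hu ht)
    ENNReal.toReal_nonneg ?_ (hb t ht).2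
  have h := ae_le_eLpNormEssSup (f := u t) (μ := volume)
  rw [← eLpNorm_exponent_top] at h
  filter_upwards [h] with x hx
  have := ENNReal.toReal_mono (memLp_top hJ hu₀ hu ht).2.ne hx
  rw [toReal_enorm, Real.norm_eq_abs] at this
  exact (le_abs_self _).trans this

/-- The energy decreases for `t > 0`; on `(0, 1]` it is at most the sup bound times the mass, which
avoids its continuity at 0. -/
theorem exists_energy_le (hH : IsHole H) (hJ : IsKernel J d)
    (hu₀ : IsInitialDatum H u₀) (hu : IsSolution H J u₀ u)
    (hdiss : ∀ t, 0 < t → 0 ≤ (∫ x, u t x ^ 2) - ∫ x, u t x * smear J (u t) x) :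
    ∃ E₀ : ℝ, 0 ≤ E₀ ∧ ∀ t, 0 < t → ∫ x, u t x ^ 2 ≤ E₀ := by
  obtain ⟨K, hK, hb⟩ := exists_mass_firstMomentum_le hH hJ hu₀ hu
  obtain ⟨B, hB, hBu⟩ := exists_le_of_le hJ hu₀ hu one_pos
  have hder := fun t (ht : 0 < t) => hasDerivAt_energy hJ hu₀ hu ht
  have hanti : AntitoneOn (fun t => ∫ x, u t x ^ 2) (Ioi 0) := by
    refine antitoneOn_of_deriv_nonpos (convex_Ioi 0)
      (fun t ht => (hder t ht).continuousAt.continuousWithinAt)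
      (fun t ht => (hder t (interior_subset ht)).differentiableAt.differentiableWithinAt)
      fun t ht => ?_
    rw [(hder t (interior_subset ht)).deriv]
    linarith [hdiss t (interior_subset ht)]
  have h1 : ∀ t ∈ Ioc (0 : ℝ) 1, ∫ x, u t x ^ 2 ≤ B * K := by
    intro t ht
    refine le_trans ?_ (mul_le_mul_of_nonneg_left (hb t ht.1.le).1 hB)
    unfold mass
    rw [← integral_const_mul]
    refine integral_mono_ae (memLp_two hJ hu₀ hu ht.1).integrable_sq
      ((hu.integrable_one ht.1.le).const_mul B) ?_
    filter_upwards [hBu, ae_nonneg hJ hu₀ hu ht.1.le] with x hx h0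
    rw [sq]
    exact mul_le_mul_of_nonneg_right ((le_abs_self _).trans (hx t ht)) h0
  refine ⟨B * K, by positivity, fun t ht => ?_⟩
  rcases le_total t 1 with h | h
  · exact h1 t ⟨ht, h⟩
  · exact (hanti (mem_Ioi.2 one_pos) ht h).trans (h1 1 ⟨one_pos, le_rfl⟩)

theorem exists_mass_le_rpow (hH : IsHole H) (hJ : IsKernel J d)
    (hu₀ : IsInitialDatum H u₀) (hu : IsSolution H J u₀ u) :
    ∃ K : ℝ, 0 < K ∧ ∀ t, 0 < t → mass u t ≤ K * t ^ (-(1 / 2) : ℝ) := by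
  obtain ⟨K₁, hK₁, hb⟩ := exists_mass_firstMomentum_le hH hJ hu₀ hu
  obtain ⟨C, hC, hnash⟩ := nash_inequality hJ
  set E : ℝ → ℝ := fun t => ∫ x, u t x ^ 2 with hEdef
  set D : ℝ → ℝ := fun t => (∫ x, u t x ^ 2) - ∫ x, u t x * smear J (u t) x with hDdef
  have hN : ∀ t, 0 < t → ∀ r > 0,
      E t ≤ C * (1 + r) ^ 2 * D t + mass u t ^ 2 / (2 * r) := fun t ht r hr =>
    hnash (u t) (hu.integrable_one ht.le) (memLp_two hJ hu₀ hu ht) (ae_nonneg hJ hu₀ hu ht.le) r hr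
  have hE0 : ∀ t, 0 ≤ E t := fun t => integral_nonneg fun x => sq_nonneg _
  have hME : ∀ t, 0 < t → mass u t ≤ (2 + K₁) * E t ^ (1 / 3 : ℝ) := fun t ht =>
    integral_le_energy_rpow (hu.integrable t ht.le) (ae_nonneg hJ hu₀ hu ht.le)
      (memLp_two hJ hu₀ hu ht) (hb t ht.le).2
  set K := 2 + K₁ with hKdef
  have hK : 0 < K := by positivity
  have hmain : ∀ t, 0 < t → 0 < E t →
      E t * (E t ^ (1 / 3 : ℝ)) ^ 2 ≤ 2 * C * (E t ^ (1 / 3 : ℝ) + K ^ 2) ^ 2 * D t := by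
    intro t ht hpos
    have hM := hME t ht
    have hM0 := mass_nonneg hJ hu₀ hu ht.le
    set e := E t ^ (1 / 3 : ℝ) with he
    have he0 : 0 < e := Real.rpow_pos_of_pos hpos _
    have hE3 : E t = e ^ 3 := by
      rw [he, ← Real.rpow_natCast, ← Real.rpow_mul hpos.le]
      norm_num
    -- This `r` makes the mass term at most `E / 2`, since the mass is at most `K * e`; it is
    -- absorbed on the left.
    have h1 := hN t ht (K ^ 2 / e) (by positivity)
    have h2 : mass u t ^ 2 / (2 * (K ^ 2 / e)) ≤ E t / 2 := by
      rw [div_le_iff₀ (by positivity), hE3]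
      have : e ^ 3 / 2 * (2 * (K ^ 2 / e)) = (K * e) ^ 2 := by
        field_simp
      rw [this]
      exact pow_le_pow_left₀ hM0 hM 2
    have h3 : E t ≤ 2 * (C * (1 + K ^ 2 / e) ^ 2 * D t) := by linarith
    calc E t * e ^ 2 ≤ 2 * (C * (1 + K ^ 2 / e) ^ 2 * D t) * e ^ 2 :=
          mul_le_mul_of_nonneg_right h3 (by positivity)
      _ = _ := by
          field_simp
  have hD0 : ∀ t, 0 < t → 0 ≤ D t := by
    intro t ht
    have h := integral_kernel_mul_transGap hJ (hu.integrable_one ht.le)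
    simp only [hDdef]
    rw [← h]
    exact integral_nonneg fun z => mul_nonneg (hJ.nonneg z)
      (transGap_nonneg (memLp_two hJ hu₀ hu ht) z)
  obtain ⟨E₀, hE₀, hEle⟩ := exists_energy_le hH hJ hu₀ hu hD0
  -- The uniform energy bound turns the factor `(e + K²)²` of `hmain` into a constant.
  set L := 2 * C * (E₀ ^ (1 / 3 : ℝ) + K ^ 2) ^ 2 with hL
  have hL0 : 0 < L := by positivity
  have hED : ∀ t, 0 < t → E t ^ (5 / 3 : ℝ) ≤ L * D t := by
    intro t ht
    rcases (hE0 t).eq_or_lt with hz | hpos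
    · rw [← hz, Real.zero_rpow (by norm_num)]
      exact mul_nonneg hL0.le (hD0 t ht)
    · have h1 : E t ^ (5 / 3 : ℝ) = E t * (E t ^ (1 / 3 : ℝ)) ^ 2 := by
        rw [← Real.rpow_natCast (E t ^ (1 / 3 : ℝ)), ← Real.rpow_mul hpos.le]
        nth_rewrite 2 [← Real.rpow_one (E t)]
        rw [← Real.rpow_add hpos]
        norm_num
      rw [h1]
      refine (hmain t ht hpos).trans (mul_le_mul_of_nonneg_right ?_ (hD0 t ht))
      have h2 : E t ^ (1 / 3 : ℝ) ≤ E₀ ^ (1 / 3 : ℝ) :=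
        Real.rpow_le_rpow hpos.le (hEle t ht) (by norm_num)
      rw [hL]
      gcongr
  refine ⟨K * (4 / (3 * L)) ^ (-(1 / 2) : ℝ), by positivity, fun t ht => ?_⟩
  rw [mul_assoc]
  exact (hME t ht).trans (mul_le_mul_of_nonneg_left (rpow_third_le_of_deriv hL0
    (fun t ht => hasDerivAt_energy hJ hu₀ hu ht) hE0 hED ht) hK.le)

/-- Testing with `x²` cut off in the hole gives `M₂' ≤ d² M ≤ d² K t^(-1/2)`. This bound is singular
at 0 but has the continuous primitive `2 d² K t^(1/2)`, which is subtracted to get a nonincreasing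
function on `[0, ∞)`. -/
theorem secondMomentum_le (hH : IsHole H) (hJ : IsKernel J d)
    (hu₀ : IsInitialDatum H u₀) (hu : IsSolution H J u₀ u) :
    ∃ K : ℝ, ∀ t, 0 ≤ t → secondMomentum u t ≤ secondMomentum u 0 + K * t ^ (1 / 2 : ℝ) := by
  obtain ⟨K, hK, hdec⟩ := exists_mass_le_rpow hH hJ hu₀ hu
  set ψ := Hᶜ.indicator fun y : ℝ => y ^ 2 with hψdef
  have hψ : AEStronglyMeasurable ψ volume :=
    (continuous_pow 2).aestronglyMeasurable.indicator hH.isOpen.measurableSet.compl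
  have hC : ∀ x, |ψ x| ≤ 1 * (1 + x ^ 2) := by
    intro x
    have h2 := sq_nonneg x
    by_cases hx : x ∈ H
    · simp only [hψdef, indicator_of_notMem (notMem_compl_iff.2 hx), abs_zero]
      positivity
    · simp only [hψdef, indicator_of_mem (show x ∈ Hᶜ from hx), abs_of_nonneg h2]
      linarith
  have hψH : ∀ x ∈ H, ψ x = 0 := fun x hx => indicator_of_notMem (notMem_compl_iff.2 hx) _
  have hM2 : ∀ t, 0 ≤ t → secondMomentum u t = ∫ x, ψ x * u t x := by
    intro t ht
    refine integral_congr_ae ?_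
    filter_upwards [ae_zero_on_hole hu₀ hu ht] with x hx
    by_cases h : x ∈ H
    · simp [hx h]
    · simp only [hψdef, indicator_of_mem (show x ∈ Hᶜ from h)]
      ring
  have hder : ∀ t, 0 < t → HasDerivAt
      (fun t => (∫ x, ψ x * u t x) - 2 * (d ^ 2 * K) * t ^ (1 / 2 : ℝ))
      ((∫ x, u t x * nonlocalOp J ψ x) - d ^ 2 * K * t ^ (-(1 / 2) : ℝ)) t := by
    intro t ht
    have h2 := (Real.hasDerivAt_rpow_const (x := t) (p := (1 / 2 : ℝ)) (Or.inl ht.ne')).const_mul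
      (2 * (d ^ 2 * K))
    refine ((hasDerivAt_integral_mul hJ hu₀ hu hψ hC hψH ht).sub h2).congr_deriv ?_
    rw [show (1 / 2 - 1 : ℝ) = -(1 / 2) by norm_num]
    ring
  have hanti : AntitoneOn (fun t => (∫ x, ψ x * u t x) - 2 * (d ^ 2 * K) * t ^ (1 / 2 : ℝ))
      (Ici 0) := by
    refine antitoneOn_of_deriv_nonpos (convex_Ici 0) ?_ ?_ ?_
    · refine (hu.continuousOn_integral hψ hC).sub (Continuous.continuousOn ?_)
      exact (Real.continuous_rpow_const (by norm_num)).const_mul _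
    · rw [interior_Ici]
      exact fun t ht => (hder t ht).differentiableAt.differentiableWithinAt
    · rw [interior_Ici]
      intro t ht
      rw [(hder t ht).deriv, sub_nonpos]
      have h1 : ∫ x, u t x * nonlocalOp J ψ x ≤ d ^ 2 * mass u t := by
        unfold mass
        rw [← integral_const_mul]
        refine integral_mono_ae ?_ ((hu.integrable_one (le_of_lt ht)).const_mul _) ?_
        · simp only [nonlocalOp_eq_smear_sub, mul_sub]
          refine (integrable_smear_mul hJ (hu.integrable t (le_of_lt ht)) hψ hC).sub ?_
          simpa only [mul_comm] using integrable_weight_mul (hu.integrable t (le_of_lt ht)) hψ hC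
        · filter_upwards [ae_nonneg_of_pos hJ hu₀ hu, hu.zero_on_hole] with x h0 hz
          by_cases hx : x ∈ H
          · simp [hz hx t ht]
          · rw [mul_comm]
            exact mul_le_mul_of_nonneg_right (nonlocalOp_indicator_sq_le hH hJ hx) (h0 t ht)
      refine h1.trans ?_
      rw [mul_assoc]
      exact mul_le_mul_of_nonneg_left (hdec t ht) (sq_nonneg d)
  refine ⟨2 * (d ^ 2 * K), fun t ht => ?_⟩
  have h := hanti (mem_Ici.2 le_rfl) ht ht
  simp only [Real.zero_rpow (show (1 / 2 : ℝ) ≠ 0 by norm_num), mul_zero, sub_zero] at h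
  rw [hM2 t ht, hM2 0 le_rfl]
  linarith

/-- The integral of the solution against a stationary solution is conserved. -/
theorem integral_mul_stationary (hJ : IsKernel J d) (hu₀ : IsInitialDatum H u₀)
    (hu : IsSolution H J u₀ u) {φ : ℝ → ℝ} {C : ℝ} (hφm : AEStronglyMeasurable φ volume)
    (hC : ∀ x, |φ x| ≤ C * (1 + x ^ 2)) (hφ : ∀ x, x ∉ H → nonlocalOp J φ x = 0)
    (hφH : ∀ x ∈ H, φ x = 0) {t : ℝ} (ht : 0 ≤ t) :
    ∫ x, φ x * u t x = ∫ x, u₀ x * φ x := by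
  have hder : ∀ t, 0 < t → HasDerivAt (fun t => ∫ x, φ x * u t x) 0 t := by
    intro t ht
    refine (hasDerivAt_integral_mul hJ hu₀ hu hφm hC hφH ht).congr_deriv
      (integral_eq_zero_of_ae ?_)
    filter_upwards [hu.zero_on_hole] with x hz
    by_cases hx : x ∈ H
    · simp [hz hx t ht]
    · simp [hφ x hx]
  have hconst : ∫ x, φ x * u t x = ∫ x, φ x * u 0 x := by
    have hcont := hu.continuousOn_integral hφm hC
    have hdiff : DifferentiableOn ℝ (fun t => ∫ x, φ x * u t x) (interior (Ici 0)) := by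
      rw [interior_Ici]
      exact fun t ht => (hder t ht).differentiableAt.differentiableWithinAt
    have hderiv : ∀ t ∈ interior (Ici (0 : ℝ)), deriv (fun t => ∫ x, φ x * u t x) t = 0 := by
      rw [interior_Ici]
      exact fun t ht => (hder t ht).deriv
    exact le_antisymm
      (antitoneOn_of_deriv_nonpos (convex_Ici 0) hcont hdiff (fun t ht => (hderiv t ht).le)
        (mem_Ici.2 le_rfl) ht ht)
      (monotoneOn_of_deriv_nonneg (convex_Ici 0) hcont hdiff (fun t ht => (hderiv t ht).ge)
        (mem_Ici.2 le_rfl) ht ht)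
  rw [hconst]
  refine integral_congr_ae ?_
  filter_upwards [hu.initial] with x hx
  rw [hx, mul_comm]

/-- A first momentum and the corresponding conserved quantity differ by a multiple of the mass. -/
theorem exists_abs_sub_le_mass (hJ : IsKernel J d) (hu₀ : IsInitialDatum H u₀)
    (hu : IsSolution H J u₀ u) {φ : ℝ → ℝ} {bp bm : ℝ} (hbp : |bp| ≤ 1) (hbm : |bm| ≤ 1)
    (hφ : IsStationary H J bp bm φ) :
    ∃ C : ℝ, 0 < C ∧ ∀ t, 0 ≤ t →
      |(∫ x, u t x * max (bp * x) (-(bm * x))) - ∫ x, u₀ x * φ x| ≤ C * mass u t := by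
  obtain ⟨C, hC⟩ := hφ.bounded
  have hC0 : 0 ≤ C := (abs_nonneg _).trans (hC 0)
  have hm : ∀ x : ℝ, |max (bp * x) (-(bm * x))| ≤ 1 * (1 + x ^ 2) := by
    intro x
    have h1 : |bp * x| ≤ |x| := by
      rw [abs_mul]; exact mul_le_of_le_one_left (abs_nonneg x) hbp
    have h2 : |-(bm * x)| ≤ |x| := by
      rw [abs_neg, abs_mul]; exact mul_le_of_le_one_left (abs_nonneg x) hbm
    rw [one_mul]
    exact (abs_max_le_max_abs_abs.trans (max_le h1 h2)).trans (abs_le_one_add_sq x)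
  have hmm : AEStronglyMeasurable (fun x : ℝ => max (bp * x) (-(bm * x))) volume :=
    Continuous.aestronglyMeasurable (by fun_prop)
  have hφC : ∀ x, |φ x| ≤ (C + 1) * (1 + x ^ 2) := by
    intro x
    have h1 := abs_add_le (φ x - max (bp * x) (-(bm * x))) (max (bp * x) (-(bm * x)))
    rw [sub_add_cancel] at h1
    nlinarith [hC x, hm x, mul_nonneg hC0 (sq_nonneg x)]
  have hφm := hφ.locallyIntegrable.aestronglyMeasurable
  -- The distance bound `C` would suffice for the estimate; adding 1 makes the constant strictly
  -- positive.
  refine ⟨C + 1, by positivity, fun t ht => ?_⟩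
  have i1 := integrable_weight_mul (hu.integrable t ht) hmm hm
  have i2 := integrable_weight_mul (hu.integrable t ht) hφm hφC
  rw [← integral_mul_stationary hJ hu₀ hu hφm hφC hφ.equation hφ.zero_on_hole ht]
  simp only [mul_comm (u t _)]
  rw [← MeasureTheory.integral_sub i1 i2, mass, ← integral_const_mul]
  refine abs_integral_le_integral_abs.trans (integral_mono_ae (i1.sub i2).abs
    ((hu.integrable_one ht).const_mul _) ?_)
  filter_upwards [ae_nonneg hJ hu₀ hu ht] with x hx
  simp only [← sub_mul, abs_mul, abs_of_nonneg hx]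
  refine mul_le_mul_of_nonneg_right ?_ hx
  rw [abs_sub_comm]
  linarith [hC x]

theorem firstMomentumPos_eq (u : ℝ → ℝ → ℝ) (t : ℝ) :
    firstMomentumPos u t = ∫ x, u t x * max (1 * x) (-(0 * x)) := by
  unfold firstMomentumPos
  rw [← integral_indicator measurableSet_Ioi]
  refine integral_congr_ae (ae_of_all _ fun x => ?_)
  by_cases hx : 0 < x
  · simp [hx, abs_of_pos hx, hx.le]
  · simp [hx, not_lt.1 hx]

theorem firstMomentumNeg_eq (u : ℝ → ℝ → ℝ) (t : ℝ) :
    firstMomentumNeg u t = ∫ x, u t x * max (0 * x) (-(1 * x)) := by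
  unfold firstMomentumNeg
  rw [← integral_indicator measurableSet_Iio]
  refine integral_congr_ae (ae_of_all _ fun x => ?_)
  by_cases hx : x < 0
  · simp [hx, abs_of_neg hx, hx.le]
  · simp [hx, not_lt.1 hx]

theorem firstMomentum_eq (u : ℝ → ℝ → ℝ) (t : ℝ) :
    firstMomentum u t = ∫ x, u t x * max (1 * x) (-(1 * x)) := by
  simp [firstMomentum, abs_eq_max_neg]

theorem mass_isBigO (hH : IsHole H) (hJ : IsKernel J d) (hu₀ : IsInitialDatum H u₀)
    (hu : IsSolution H J u₀ u) : mass u =O[atTop] fun t : ℝ => t ^ (-(1 / 2) : ℝ) := by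
  obtain ⟨K, hK, hdec⟩ := exists_mass_le_rpow hH hJ hu₀ hu
  refine IsBigO.of_bound K ?_
  filter_upwards [eventually_gt_atTop 0] with t ht
  rw [Real.norm_of_nonneg (mass_nonneg hJ hu₀ hu ht.le), Real.norm_of_nonneg (by positivity)]
  exact hdec t ht

theorem isBigO_of_le_mass (hH : IsHole H) (hJ : IsKernel J d) (hu₀ : IsInitialDatum H u₀)
    (hu : IsSolution H J u₀ u) {F : ℝ → ℝ} {a C : ℝ}
    (hF : ∀ t, 0 ≤ t → |F t - a| ≤ C * mass u t) :
    (fun t => |F t - a|) =O[atTop] (fun t : ℝ => t ^ (-(1 / 2) : ℝ)) := by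
  refine IsBigO.trans (IsBigO.of_bound C ?_) (mass_isBigO hH hJ hu₀ hu)
  filter_upwards [eventually_ge_atTop 0] with t ht
  rw [Real.norm_of_nonneg (mass_nonneg hJ hu₀ hu ht), Real.norm_of_nonneg (abs_nonneg _)]
  exact hF t ht

end IsSolution

theorem tendsto_rpow_neg_half : Tendsto (fun t : ℝ => t ^ (-(1 / 2) : ℝ)) atTop (𝓝 0) :=
  tendsto_rpow_neg_atTop (by norm_num)

theorem tendsto_of_isBigO_abs_sub {F : ℝ → ℝ} {a : ℝ}
    (hF : (fun t => |F t - a|) =O[atTop] (fun t : ℝ => t ^ (-(1 / 2) : ℝ))) :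
    Tendsto F atTop (𝓝 a) :=
  tendsto_iff_norm_sub_tendsto_zero.2 (hF.trans_tendsto tendsto_rpow_neg_half)

end NonlocalHole

end

theorem proposition3p3 (H : Set ℝ) (J : ℝ → ℝ) (d : ℝ) (u₀ : ℝ → ℝ) (u : ℝ → ℝ → ℝ)
    (hH : NonlocalHole.IsHole H) (hJ : NonlocalHole.IsKernel J d)
    (hu₀ : NonlocalHole.IsInitialDatum H u₀) (hu : NonlocalHole.IsSolution H J u₀ u) :
    -- the solution is bounded at every time, so that its sup norm is meaningful
    (∀ t : ℝ, 0 ≤ t → MemLp (u t) ⊤ volume) ∧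
    -- right half-line first momentum
    (∀ φp : ℝ → ℝ, NonlocalHole.IsStationary H J 1 0 φp →
      (∃ C C' : ℝ, 0 < C ∧ 0 < C' ∧ ∀ t : ℝ, 0 ≤ t →
        |NonlocalHole.firstMomentumPos u t - ∫ x, u₀ x * φp x| ≤ C * NonlocalHole.mass u t ∧
        C * NonlocalHole.mass u t ≤ C' * NonlocalHole.supNorm (u t) ^ (1 / 2 : ℝ)) ∧
      (fun t : ℝ => |NonlocalHole.firstMomentumPos u t - ∫ x, u₀ x * φp x|)
        =O[atTop] (fun t : ℝ => t ^ (-(1 / 2) : ℝ)) ∧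
      Tendsto (NonlocalHole.firstMomentumPos u) atTop (𝓝 (∫ x, u₀ x * φp x))) ∧
    -- left half-line first momentum
    (∀ φm : ℝ → ℝ, NonlocalHole.IsStationary H J 0 1 φm →
      (∃ C C' : ℝ, 0 < C ∧ 0 < C' ∧ ∀ t : ℝ, 0 ≤ t →
        |NonlocalHole.firstMomentumNeg u t - ∫ x, u₀ x * φm x| ≤ C * NonlocalHole.mass u t ∧
        C * NonlocalHole.mass u t ≤ C' * NonlocalHole.supNorm (u t) ^ (1 / 2 : ℝ)) ∧
      (fun t : ℝ => |NonlocalHole.firstMomentumNeg u t - ∫ x, u₀ x * φm x|)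
        =O[atTop] (fun t : ℝ => t ^ (-(1 / 2) : ℝ)) ∧
      Tendsto (NonlocalHole.firstMomentumNeg u) atTop (𝓝 (∫ x, u₀ x * φm x))) ∧
    -- whole-line first momentum
    (∀ φ₁ : ℝ → ℝ, NonlocalHole.IsStationary H J 1 1 φ₁ →
      (fun t : ℝ => |NonlocalHole.firstMomentum u t - ∫ x, u₀ x * φ₁ x|)
        =O[atTop] (fun t : ℝ => t ^ (-(1 / 2) : ℝ))) ∧
    -- mass
    (∃ K : ℝ, ∀ t : ℝ, 0 ≤ t →
      NonlocalHole.mass u t ≤ K * NonlocalHole.supNorm (u t) ^ (1 / 2 : ℝ)) ∧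
    (NonlocalHole.mass u =O[atTop] (fun t : ℝ => t ^ (-(1 / 2) : ℝ))) ∧
    Tendsto (NonlocalHole.mass u) atTop (𝓝 0) ∧
    -- second momentum
    (∃ K : ℝ, ∀ t : ℝ, 0 ≤ t → NonlocalHole.secondMomentum u t ≤
      NonlocalHole.secondMomentum u 0 + K * t ^ (1 / 2 : ℝ)) := by
  obtain ⟨K, hK, hsup⟩ := NonlocalHole.IsSolution.exists_mass_le_supNorm hH hJ hu₀ hu
  have hmass := NonlocalHole.IsSolution.mass_isBigO hH hJ hu₀ hu
  refine ⟨fun t ht => NonlocalHole.IsSolution.memLp_top hJ hu₀ hu ht, fun φp hφ => ?_,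
    fun φm hφ => ?_, fun φ₁ hφ => ?_, ⟨K, hsup⟩, hmass,
    hmass.trans_tendsto NonlocalHole.tendsto_rpow_neg_half,
    NonlocalHole.IsSolution.secondMomentum_le hH hJ hu₀ hu⟩
  · obtain ⟨C, hC, hle⟩ := NonlocalHole.IsSolution.exists_abs_sub_le_mass hJ hu₀ hu (by simp) (by simp) hφ
    simp only [← NonlocalHole.IsSolution.firstMomentumPos_eq] at hle
    have hO := NonlocalHole.IsSolution.isBigO_of_le_mass hH hJ hu₀ hu hle
    refine ⟨⟨C, C * K, hC, mul_pos hC hK, fun t ht => ⟨hle t ht, ?_⟩⟩, hO,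
      NonlocalHole.tendsto_of_isBigO_abs_sub hO⟩
    rw [mul_assoc]
    exact mul_le_mul_of_nonneg_left (hsup t ht) hC.le
  · obtain ⟨C, hC, hle⟩ := NonlocalHole.IsSolution.exists_abs_sub_le_mass hJ hu₀ hu (by simp) (by simp) hφ
    simp only [← NonlocalHole.IsSolution.firstMomentumNeg_eq] at hle
    have hO := NonlocalHole.IsSolution.isBigO_of_le_mass hH hJ hu₀ hu hle
    refine ⟨⟨C, C * K, hC, mul_pos hC hK, fun t ht => ⟨hle t ht, ?_⟩⟩, hO,
      NonlocalHole.tendsto_of_isBigO_abs_sub hO⟩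
    rw [mul_assoc]
    exact mul_le_mul_of_nonneg_left (hsup t ht) hC.le
  · obtain ⟨C, hC, hle⟩ := NonlocalHole.IsSolution.exists_abs_sub_le_mass hJ hu₀ hu (by simp) (by simp) hφ
    simp only [← NonlocalHole.IsSolution.firstMomentum_eq] at hle
    exact NonlocalHole.IsSolution.isBigO_of_le_mass hH hJ hu₀ hu hle
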